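/- Let $\mathbb{k}$ be any field and $N \geq 0$ an integer. Let $S = \mathbb{k}[x_{ij} \mid 1 \leq i < j \leq N]$, let $X$ be the generic $N \times N$ skew-symmetric matrix (with entry $x_{ij}$ in position $(i,j)$ for $i<j$), and put $n = \lfloor N/2 \rfloor$. Let $\mathcal{D}$ be the graded dual of $S$, with $\mathbb{k}$-basis $\{\mathbf{X}^{\beta}\}$ dual to the monomials $\mathbf{x}^{\beta}$ of $S$, regarded as an $S$-module via the contraction action: $\mathbf{x}^{\alpha} \circ \mathbf{X}^{\beta} = \mathbf{X}^{\beta-\alpha}$ if $\beta \geq \alpha$ componentwise, and $0$ otherwise. The $2n$-Pfaffians of $X$ (the Pfaffians of its principal $2n \times 2n$ submatrices) are linear combinations of squarefree monomials, and are regarded as elements of $\mathcal{D}$ by reading $\mathbf{x}^\beta$ as $\mathbf{X}^\beta$. Let $M \subseteq \mathcal{D}$ be the $S$-submodule that they generate and let $I = \{f \in S \mid f \circ F = 0 \text{ for all } F \in M\}$ be its apolar ideal. Let \[\begin{split}\mathcal{G} = \ &\{x_{ij}^2 \mid 1 \leq i < j \leq N\} \cup \{x_{ij}x_{ik},\ x_{ij}x_{jk},\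 x_{ik}x_{jk} \mid 1 \leq i < j < k \leq N\}\\ \cup\ &\{x_{ij}x_{k\ell}+x_{ik}x_{j\ell},\ x_{i\ell}x_{jk}+x_{ik}x_{j\ell},\ x_{ij}x_{k\ell} - x_{i\ell}x_{jk} \mid 1 \leq i < j < k < \ell \leq N\}.\end{split}\] Then: (1) $\mathcal{G}$ consists of exactly $\binom{N}{2} + 3\binom{N}{3} + 3\binom{N}{4}$ quadrics (nonzero homogeneous polynomials of degree $2$). Each of them is tidy, i.e., each variable of $S$ divides at most one monomial in its support. Moreover, $\mathcal{G}$ is a revlex-universal Gröbner basis of $I$, i.e., a Gröbner basis of $I$ with respect to the degree reverse lexicographic order attached to any total order on the variables. (2) Removing from $\mathcal{G}$, for each $i<j<k<\ell$, any one of the three polynomials $x_{ij}x_{k\ell}+x_{ik}x_{j\ell}$, $x_{i\ell}x_{jk}+x_{ik}x_{j\ell}$, $x_{ij}x_{k\ell} - x_{i\ell}x_{jk}$ yields a minimal generating set of $I$ (it generates $I$, and no proper subset of it does). (3) $R = S/I$ is strongly Koszul with respect to the variables: with the grading induced from $S$, $R$ is a standard graded $\mathbb{k}$-algebra, the residue classes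 $\overline{x}_{ij}$ form a $\mathbb{k}$-basis $B$ of $R_1$, and for every proper subset $A \subsetneq B$ and every $b \in B \setminus A$ the colon ideal $(A) :_R b$ is generated by elements of $B$. -/

import Mathlib

open MvPolynomial

noncomputable section

namespace PfaffianApolarity

/-! ### Degree reverse lexicographic orders -/

/-- The exponent vectors `σ →₀ ℕ`, to be ordered by the degree reverse lexicographic order. -/
def DegRevLex (σ : Type*) : Type _ := σ →₀ ℕ

namespace DegRevLex

instance (σ : Type*) : AddCommMonoid (DegRevLex σ) := inferInstanceAs (AddCommMonoid (σ →₀ ℕ))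

/-- The identity map, forgetting the order. -/
def toFinsupp {σ : Type*} (a : DegRevLex σ) : σ →₀ ℕ := a

/-- The total degree, followed by the exponents from the lowest variable upwards, in the reversed
lexicographic order. -/
def key {σ : Type*} (a : DegRevLex σ) : ℕ ×ₗ (Lex (σ →₀ ℕ))ᵒᵈ :=
  toLex (a.toFinsupp.degree, OrderDual.toDual (toLex a.toFinsupp))

theorem key_injective {σ : Type*} : Function.Injective (key (σ := σ)) := fun _ _ h =>
  toLex.injective (OrderDual.toDual.injective
    (congrArg (fun x : ℕ ×ₗ (Lex (σ →₀ ℕ))ᵒᵈ => (ofLex x).2) h))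

/-- Compare total degrees first; in case of equality reverse the lexicographic comparison that
starts with the lowest variable. -/
instance (σ : Type*) [LinearOrder σ] : LinearOrder (DegRevLex σ) :=
  LinearOrder.lift' key key_injective

theorem lt_iff {σ : Type*} [LinearOrder σ] {a b : DegRevLex σ} :
    a < b ↔ a.toFinsupp.degree < b.toFinsupp.degree ∨
      (a.toFinsupp.degree = b.toFinsupp.degree ∧
        toLex b.toFinsupp < toLex a.toFinsupp) :=
  Prod.Lex.lt_iff (x := key a) (y := key b)

theorem le_iff {σ : Type*} [LinearOrder σ] {a b : DegRevLex σ} :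
    a ≤ b ↔ a.toFinsupp.degree < b.toFinsupp.degree ∨
      (a.toFinsupp.degree = b.toFinsupp.degree ∧
        toLex b.toFinsupp ≤ toLex a.toFinsupp) :=
  Prod.Lex.le_iff (x := key a) (y := key b)

theorem toFinsupp_add {σ : Type*} (a b : DegRevLex σ) :
    (a + b).toFinsupp = a.toFinsupp + b.toFinsupp := rfl

instance (σ : Type*) [LinearOrder σ] : IsOrderedAddMonoid (DegRevLex σ) where
  add_le_add_left a b h c := by
    rw [le_iff] at h ⊢
    simpa [toFinsupp_add, map_add, toLex_add] using h

theorem monotone_ofFinsupp {σ : Type*} [LinearOrder σ] {a b : σ →₀ ℕ} (h : a ≤ b) :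
    (show DegRevLex σ from a) ≤ (show DegRevLex σ from b) := by
  rw [le_iff]
  change a.degree < b.degree ∨ (a.degree = b.degree ∧ toLex b ≤ toLex a)
  obtain ⟨c, rfl⟩ := exists_add_of_le h
  by_cases hc : c = 0
  · right; simp [hc]
  · left
    have : c.degree ≠ 0 := fun h0 => hc ((Finsupp.degree_eq_zero_iff c).1 h0)
    rw [map_add]
    omega

instance (σ : Type*) [Finite σ] [LinearOrder σ] : WellFoundedLT (DegRevLex σ) := by
  constructor
  rw [RelEmbedding.wellFounded_iff_isEmpty]
  refine ⟨fun f => ?_⟩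
  obtain ⟨m, n, hmn, hle⟩ := wellQuasiOrdered_le (α := σ →₀ ℕ) (fun i => (f i).toFinsupp)
  exact absurd (monotone_ofFinsupp hle) (not_le_of_gt (f.map_rel_iff.2 hmn))

end DegRevLex

/-- The degree reverse lexicographic order attached to a total order on the variables. -/
def degRevLex (σ : Type*) [Finite σ] [LinearOrder σ] : MonomialOrder σ where
  syn := DegRevLex σ
  toSyn := { toFun := fun a => a, invFun := fun a => a, map_add' := fun _ _ => rfl }
  toSyn_monotone _ _ h := DegRevLex.monotone_ofFinsupp h

open scoped MonomialOrder in
/-- `x^a < x^b` if and only if `x^a` has smaller degree, or the degrees agree and the lowest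
variable whose exponents in `x^a` and `x^b` differ has larger exponent in `x^a`. -/
theorem degRevLex_lt_iff {σ : Type*} [Finite σ] [LinearOrder σ] {a b : σ →₀ ℕ} :
    a ≺[degRevLex σ] b ↔
      a.degree < b.degree ∨ (a.degree = b.degree ∧ ∃ i, (∀ j < i, b j = a j) ∧ b i < a i) :=
  DegRevLex.lt_iff

/-! ### Gröbner bases and tidy polynomials -/

/-- `G ⊆ I`, and the leading terms of the elements of `G` generate the initial ideal of `I`. -/
def IsGroebnerBasis {σ k : Type*} [Field k] (m : MonomialOrder σ)
    (G : Set (MvPolynomial σ k)) (I : Ideal (MvPolynomial σ k)) : Prop :=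
  G ⊆ I ∧ Ideal.span (m.leadingTerm '' G) =
    Ideal.span (m.leadingTerm '' (I : Set (MvPolynomial σ k)))

/-- `G` is a Gröbner basis with respect to the degree reverse lexicographic order attached to any
total order on the variables. -/
def IsRevlexUniversalGroebnerBasis {σ k : Type*} [Finite σ] [Field k]
    (G : Set (MvPolynomial σ k)) (I : Ideal (MvPolynomial σ k)) : Prop :=
  ∀ _ : LinearOrder σ, IsGroebnerBasis (degRevLex σ) G I

/-- A homogeneous polynomial such that each variable divides at most one monomial in its
support. -/
def IsTidy {σ k : Type*} [Field k] (f : MvPolynomial σ k) : Prop :=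
  (∃ d, f.IsHomogeneous d) ∧
    ∀ v, ∀ a ∈ f.support, ∀ b ∈ f.support, a v ≠ 0 → b v ≠ 0 → a = b

/-- A nonzero homogeneous polynomial of degree two. -/
def IsQuadric {σ k : Type*} [Field k] (f : MvPolynomial σ k) : Prop :=
  f.IsHomogeneous 2 ∧ f ≠ 0

/-- `G` generates `I` and no proper subset of `G` does. -/
def IsMinimalGeneratingSet {R : Type*} [CommRing R] (G : Set R) (I : Ideal R) : Prop :=
  Ideal.span G = I ∧ ∀ T : Set R, T ⊂ G → Ideal.span T ≠ I

/-! ### Strongly Koszul algebras -/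

/-- `𝒜` is a grading on the `k`-algebra `R` that makes it a standard graded `k`-algebra:
`R₀ = k`, and `R` is generated as a `k`-algebra by the finite dimensional space `R₁`. -/
structure IsStandardGraded (k : Type*) {R : Type*} [Field k] [CommRing R] [Algebra k R]
    (𝒜 : ℕ → Submodule k R) : Prop where
  nontrivial : Nontrivial R
  gradedMonoid : SetLike.GradedMonoid 𝒜
  isInternal : DirectSum.IsInternal 𝒜
  degree_zero : 𝒜 0 = LinearMap.range (Algebra.linearMap k R)
  adjoin_degree_one : Algebra.adjoin k (𝒜 1 : Set R) = ⊤
  finite_degree_one : Module.Finite k (𝒜 1)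

/-- The standard graded `k`-algebra `R` is strongly Koszul with respect to the `k`-basis `b` of
`R₁`: for every proper subset `A` of the basis and every basis element `b i` outside of `A`, the
colon ideal `(A) : b i` is generated by elements of the basis. -/
structure IsStronglyKoszulWrt {k R ι : Type*} [Field k] [CommRing R] [Algebra k R]
    (𝒜 : ℕ → Submodule k R) (b : ι → R) : Prop where
  standard : IsStandardGraded k 𝒜
  linearIndependent : LinearIndependent k b
  span_eq : Submodule.span k (Set.range b) = 𝒜 1
  colon : ∀ (A : Set ι) (i : ι), i ∉ A →
    ∃ C : Set ι, (Ideal.span (b '' A)).colon {b i} = Ideal.span (b '' C)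

/-- The family of subspaces of `S / I` induced by the standard grading of the polynomial
ring `S`. -/
def quotientGrading {σ k : Type*} [Field k] (I : Ideal (MvPolynomial σ k)) (d : ℕ) :
    Submodule k (MvPolynomial σ k ⧸ I) :=
  (homogeneousSubmodule σ k d).map (Ideal.Quotient.mkₐ k I).toLinearMap

/-! ### Macaulay's inverse system -/

/-- The graded dual `𝒟` of the polynomial ring `S = k[x_v | v ∈ σ]` (for finite `σ`), through its
basis of the functionals `X^β` dual to the monomials `x^β`: a finitely supported function `F`
stands for `∑ F(β) X^β`. -/
def GradedDual (σ k : Type*) [Field k] : Type _ := (σ →₀ ℕ) →₀ k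

namespace GradedDual

variable {σ k : Type*} [Field k]

instance : AddCommGroup (GradedDual σ k) := inferInstanceAs (AddCommGroup ((σ →₀ ℕ) →₀ k))

instance : Module k (GradedDual σ k) := inferInstanceAs (Module k ((σ →₀ ℕ) →₀ k))

/-- The basis element `X^β`. -/
def X (k : Type*) [Field k] (β : σ →₀ ℕ) : GradedDual σ k := Finsupp.single β (1 : k)

/-- Contraction by `x^α`: the coefficient of `X^β` in `x^α ∘ F` is the coefficient of `X^(α + β)`
in `F`. -/
def contractMonomial (α : σ →₀ ℕ) : GradedDual σ k →ₗ[k] GradedDual σ k :=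
  (Finsupp.lcomapDomain (fun β => α + β) (add_right_injective α) :
    ((σ →₀ ℕ) →₀ k) →ₗ[k] ((σ →₀ ℕ) →₀ k))

theorem contractMonomial_apply (α : σ →₀ ℕ) (F : (σ →₀ ℕ) →₀ k) (β : σ →₀ ℕ) :
    (show (σ →₀ ℕ) →₀ k from contractMonomial α (show GradedDual σ k from F)) β = F (α + β) :=
  rfl

theorem contractMonomial_zero (F : GradedDual σ k) : contractMonomial 0 F = F :=
  Finsupp.ext fun β => congrArg (show (σ →₀ ℕ) →₀ k from F) (zero_add β)

theorem contractMonomial_add (α α' : σ →₀ ℕ) (F : GradedDual σ k) :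
    contractMonomial (α + α') F = contractMonomial α (contractMonomial α' F) :=
  Finsupp.ext fun β => congrArg (show (σ →₀ ℕ) →₀ k from F) (by
    change α + α' + β = α' + (α + β)
    rw [add_comm α α', add_assoc])

/-- The contraction action of `S` on `𝒟`, extended linearly from the monomials. -/
def contraction : MvPolynomial σ k →ₐ[k] Module.End k (GradedDual σ k) :=
  AddMonoidAlgebra.lift k (Module.End k (GradedDual σ k)) (σ →₀ ℕ)
    { toFun := fun α => contractMonomial α.toAdd
      map_one' := LinearMap.ext contractMonomial_zero
      map_mul' := fun α α' => LinearMap.ext (contractMonomial_add α.toAdd α'.toAdd) }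

/-- `𝒟` as an `S`-module with respect to the contraction action. -/
instance : Module (MvPolynomial σ k) (GradedDual σ k) :=
  Module.compHom (GradedDual σ k) (contraction (σ := σ) (k := k)).toRingHom

theorem smul_def (f : MvPolynomial σ k) (F : GradedDual σ k) : f • F = contraction f F := rfl

open Classical in
theorem monomial_smul_X (α β : σ →₀ ℕ) :
    (monomial α (1 : k)) • X k β = if α ≤ β then X k (β - α) else 0 := by
  have h : contraction (monomial α (1 : k)) = contractMonomial α := by
    rw [← single_eq_monomial]
    exact (AddMonoidAlgebra.lift_single _ _ _).trans (one_smul k _)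
  rw [smul_def, h]
  refine Finsupp.ext fun γ => ?_
  change (Finsupp.single β (1 : k)) (α + γ) = _
  split_ifs with hle
  · change _ = (Finsupp.single (β - α) (1 : k)) γ
    rw [Finsupp.single_apply, Finsupp.single_apply]
    refine if_congr ?_ rfl rfl
    constructor
    · rintro rfl; simp
    · rintro rfl; exact (add_tsub_cancel_of_le hle).symm
  · change _ = (0 : k)
    refine Finsupp.single_eq_of_ne ?_
    rintro rfl
    exact hle le_self_add

/-- Read a polynomial as the element of `𝒟` with the same coefficients. On linear combinations of
squarefree monomials this replaces each variable `x_v` by the dual variable `X_v`. -/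
def ofPolynomial (f : MvPolynomial σ k) : GradedDual σ k :=
  ∑ β ∈ f.support, f.coeff β • X k β

end GradedDual

/-! ### Pfaffians -/

/-- The Pfaffian `∑ sign(π) a_{π(1)π(2)} a_{π(3)π(4)} ⋯ a_{π(2m-1)π(2m)}` of a matrix of size
`2m`, where `π` runs over the permutations with `π(2i-1) < π(2i)` for all `i` and
`π(1) < π(3) < ⋯ < π(2m-1)`, that is, over the perfect matchings of the index set. -/
def pfaffian {R : Type*} [CommRing R] {m : ℕ} (A : Matrix (Fin (2 * m)) (Fin (2 * m)) R) : R :=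
  let odd (i : Fin m) : Fin (2 * m) := ⟨2 * i, by omega⟩
  let even (i : Fin m) : Fin (2 * m) := ⟨2 * i + 1, by omega⟩
  ∑ π : Equiv.Perm (Fin (2 * m)) with
      (∀ i, π (odd i) < π (even i)) ∧ StrictMono (fun i => π (odd i)),
    ((Equiv.Perm.sign π : ℤ) : R) * ∏ i, A (π (odd i)) (π (even i))

/-- The index set of the variables `x_{ij}` with `i < j`. -/
abbrev SkewVar (N : ℕ) : Type := {p : Fin N × Fin N // p.1 < p.2}

/-- The generic skew-symmetric `N × N` matrix, with entries in `k[x_{ij} | i < j]`. -/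
def genericSkew (k : Type*) [Field k] (N : ℕ) :
    Matrix (Fin N) (Fin N) (MvPolynomial (SkewVar N) k) :=
  fun i j => if h : i < j then X ⟨(i, j), h⟩ else if h : j < i then -X ⟨(j, i), h⟩ else 0

/-- The `2m`-Pfaffians of a matrix: the Pfaffians of the principal submatrices of size `2m`. -/
def pfaffians {R : Type*} [CommRing R] {N : ℕ} (A : Matrix (Fin N) (Fin N) R) (m : ℕ) : Set R :=
  Set.range fun e : Fin (2 * m) ↪o Fin N => pfaffian (A.submatrix e e)

/-- The `S`-submodule of `𝒟` generated by the maximal even Pfaffians of the generic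
skew-symmetric `N × N` matrix. -/
def pfaffianModule (k : Type*) [Field k] (N : ℕ) :
    Submodule (MvPolynomial (SkewVar N) k) (GradedDual (SkewVar N) k) :=
  Submodule.span _ (GradedDual.ofPolynomial '' pfaffians (genericSkew k N) (N / 2))

/-- The ideal apolar to the module generated by the maximal even Pfaffians. -/
def apolarIdeal (k : Type*) [Field k] (N : ℕ) : Ideal (MvPolynomial (SkewVar N) k) :=
  (pfaffianModule k N).annihilator

/-! ### The explicit quadrics (for `i < j`, `genericSkew k N i j` is the variable `x_{ij}`) -/

/-- The three polynomials attached to `i < j < k < l`. -/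
def quadrupleSet (k : Type*) [Field k] (N : ℕ) (a b c d : Fin N) :
    Set (MvPolynomial (SkewVar N) k) :=
  let x := genericSkew k N
  {x a b * x c d + x a c * x b d, x a d * x b c + x a c * x b d, x a b * x c d - x a d * x b c}

/-- The squares of the variables, the products of two variables sharing exactly one index, and the
polynomials attached to the quadruples of indices. -/
def quadrics (k : Type*) [Field k] (N : ℕ) : Set (MvPolynomial (SkewVar N) k) :=
  let x := genericSkew k N
  {f | ∃ a b, a < b ∧ f = x a b ^ 2} ∪
  {f | ∃ a b c, a < b ∧ b < c ∧ f ∈ ({x a b * x a c, x a b * x b c, x a c * x b c} : Set _)} ∪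
  {f | ∃ a b c d, a < b ∧ b < c ∧ c < d ∧ f ∈ quadrupleSet k N a b c d}

end PfaffianApolarity

end

noncomputable section

namespace PfaffianApolarity

/-! ### Vertex degrees and signs of monomials -/

section Matchings

variable {N : ℕ}

/-! A monomial is a multigraph on the vertices `1, …, N`. For a set `T` of vertices let `functional
k T` be the sum of the coefficients of a polynomial at the perfect matchings of `T`, each with the
sign given by its number of crossings. For `T` of size `2 * (N / 2)` this is the pairing with a
generating Pfaffian. Contracting such a Pfaffian by a variable `x_c` gives, up to a sign, the
Pfaffian of `T` without the ends of `c`, or zero (`functional_X_mul`). Since every even set is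
contained in one of maximal even size, `f` lies in the apolar ideal iff all the functionals vanish
on `f` (`mem_apolarIdeal_iff`).

Gröbner basis: let `α` be the leading monomial of a nonzero `f` in the ideal. If some vertex has
degree at least two in `α`, a square or a path with two edges divides `α`. Otherwise `α` is a
perfect matching of some `T`, and the vanishing of the functional of `T` forces a smaller perfect
matching `β` of `T` into the support of `f`. The lowest variable `e = ab` at which the two differ
occurs in `β` only. The edges `aa'` and `bb'` of `α` at its ends are higher than `e`, so for any
revlex order the leading monomial of `x_{aa'}x_{bb'} + x_{ab}x_{a'b'}` is the first one, and it
divides `α` (`exists_quadric_degree_le`). Up to sign this polynomial is one of the listed quadrics.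

Minimality: all monomials of a quadric have the same vertex degrees, and these determine the quadric
except for the three relations on four given vertices. Those satisfy one linear dependency, and any
two of them have distinct supports.

Strong Koszulness: the functionals of the even sets have dual elements that are scalar multiples of
matching monomials. Hence `(A) + I` is cut out by the functionals of those `T` that contain no edge
of `A` (`mem_span_X_sup_apolarIdeal_iff`), and the colon ideals reduce to a statement about graphs
(`mul_X_mem_span_X_sup_apolarIdeal_iff`). -/

/-- The set of the two endpoints of an edge. -/
def ends (c : SkewVar N) : Finset (Fin N) := {c.1.1, c.1.2}

theorem mem_ends {c : SkewVar N} {u : Fin N} : u ∈ ends c ↔ u = c.1.1 ∨ u = c.1.2 := by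
  simp [ends]

theorem card_ends (c : SkewVar N) : (ends c).card = 2 := Finset.card_pair c.2.ne

/-- The indicator function of a set of vertices. -/
def ind (T : Finset (Fin N)) (u : Fin N) : ℕ := if u ∈ T then 1 else 0

theorem ind_injective : Function.Injective (ind (N := N)) := fun S T h => by
  ext u
  have := congrFun h u
  simp only [ind] at this
  split_ifs at this <;> simp_all

theorem sum_ind (T : Finset (Fin N)) : ∑ u, ind T u = T.card := by simp [ind]

/-- The degree of a vertex in the multigraph given by a monomial. -/
def vdeg (α : SkewVar N →₀ ℕ) (u : Fin N) : ℕ := ∑ c, α c * ind (ends c) u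

theorem vdeg_add (α β : SkewVar N →₀ ℕ) : vdeg (α + β) = vdeg α + vdeg β := by
  ext u; simp [vdeg, add_mul, Finset.sum_add_distrib]

theorem vdeg_zero : vdeg (0 : SkewVar N →₀ ℕ) = 0 := by ext u; simp [vdeg]

theorem vdeg_single (c : SkewVar N) (n : ℕ) (u : Fin N) :
    vdeg (Finsupp.single c n) u = n * ind (ends c) u := by
  rw [vdeg, Finset.sum_eq_single c] <;> simp +contextual [eq_comm]

theorem vdeg_single_one (c : SkewVar N) : vdeg (Finsupp.single c 1) = ind (ends c) := by
  ext u; simp [vdeg_single]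

theorem vdeg_sum {ι : Type*} (s : Finset ι) (f : ι → SkewVar N →₀ ℕ) :
    vdeg (∑ i ∈ s, f i) = ∑ i ∈ s, vdeg (f i) := by
  classical
  induction s using Finset.induction_on with
  | empty => simp [vdeg_zero]
  | insert a s ha ih => rw [Finset.sum_insert ha, Finset.sum_insert ha, vdeg_add, ih]

theorem sum_vdeg (α : SkewVar N →₀ ℕ) : ∑ u, vdeg α u = 2 * α.degree := by
  simp only [vdeg]
  rw [Finset.sum_comm]
  simp_rw [← Finset.mul_sum, sum_ind, card_ends]
  rw [← Finset.sum_mul, mul_comm, Finsupp.degree_eq_sum]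

theorem mul_ind_le_vdeg (α : SkewVar N →₀ ℕ) (c : SkewVar N) (u : Fin N) :
    α c * ind (ends c) u ≤ vdeg α u :=
  Finset.single_le_sum (f := fun c => α c * ind (ends c) u) (fun _ _ => Nat.zero_le _)
    (Finset.mem_univ c)

theorem exists_mem_ends_of_vdeg_ne_zero {α : SkewVar N →₀ ℕ} {u : Fin N} (h : vdeg α u ≠ 0) :
    ∃ c, α c ≠ 0 ∧ u ∈ ends c := by
  obtain ⟨c, -, hc⟩ := Finset.exists_ne_zero_of_sum_ne_zero h
  refine ⟨c, left_ne_zero_of_mul hc, ?_⟩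
  have := right_ne_zero_of_mul hc
  by_contra h0
  simp [ind, h0] at this

/-! ### Crossing signs and their change when an edge is added. -/

/-- Two edges cross, with the first one starting first. -/
def crossing (c d : SkewVar N) : ℤ :=
  if c.1.1 < d.1.1 ∧ d.1.1 < c.1.2 ∧ c.1.2 < d.1.2 then -1 else 1

/-- The sign of a matching: the parity of its number of crossings. -/
def crossingSign (α : SkewVar N →₀ ℕ) : ℤ := ∏ c, ∏ d, crossing c d ^ (α c * α d)

/-- The parity of the position of a vertex relative to an edge. -/
def separation (c : SkewVar N) (u : Fin N) : ℤ := if c.1.1 < u ∧ u < c.1.2 then -1 else 1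

theorem isUnit_crossing (c d : SkewVar N) : IsUnit (crossing c d) := by
  unfold crossing; split_ifs <;> simp

theorem isUnit_separation (c : SkewVar N) (u : Fin N) : IsUnit (separation c u) := by
  unfold separation; split_ifs <;> simp

theorem crossing_self (c : SkewVar N) : crossing c c = 1 := by simp [crossing]

theorem isUnit_prod_int {ι : Type*} (s : Finset ι) (f : ι → ℤ) (h : ∀ i ∈ s, IsUnit (f i)) :
    IsUnit (∏ i ∈ s, f i) := by
  classical
  induction s using Finset.induction_on with
  | empty => simp
  | insert a s ha ih =>
    rw [Finset.prod_insert ha]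
    exact (h a (by simp)).mul (ih fun i hi => h i (by simp [hi]))

theorem isUnit_crossingSign (α : SkewVar N →₀ ℕ) : IsUnit (crossingSign α) :=
  isUnit_prod_int _ _ fun c _ => isUnit_prod_int _ _ fun d _ => (isUnit_crossing c d).pow _

theorem crossingSign_zero : crossingSign (0 : SkewVar N →₀ ℕ) = 1 := by simp [crossingSign]

theorem prod_pow_single (f : SkewVar N → ℤ) (c : SkewVar N) :
    ∏ d, f d ^ (Finsupp.single c 1 d) = f c := by
  rw [Finset.prod_eq_single c] <;> simp +contextual [eq_comm]

/-- The exponents in `crossingSign` form a quadratic expression in `α`. Adding `c` contributes the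
mixed terms in both orders, and the term of `c` with itself is trivial. -/
theorem crossingSign_single_add (c : SkewVar N) (α : SkewVar N →₀ ℕ) :
    crossingSign (Finsupp.single c 1 + α) =
      crossingSign α * ∏ d, (crossing c d * crossing d c) ^ α d := by
  have h (d d' : SkewVar N) : crossing d d' ^ ((Finsupp.single c 1 + α : SkewVar N →₀ ℕ) d *
      (Finsupp.single c 1 + α : SkewVar N →₀ ℕ) d') =
      ((crossing d d' ^ Finsupp.single c 1 d') ^ Finsupp.single c 1 d *
        (crossing d d' ^ α d') ^ Finsupp.single c 1 d) *
      ((crossing d d' ^ Finsupp.single c 1 d') ^ α d * crossing d d' ^ (α d * α d')) := by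
    simp only [Finsupp.add_apply]; ring
  simp only [crossingSign, h, Finset.prod_mul_distrib, Finset.prod_pow, prod_pow_single,
    crossing_self, one_mul, mul_pow]
  ring

/-- Disjoint edges cross iff exactly one end of `d` lies strictly between the ends of `c`. -/
theorem crossing_mul_crossing {c d : SkewVar N} (h : Disjoint (ends c) (ends d)) :
    crossing c d * crossing d c = separation c d.1.1 * separation c d.1.2 := by
  obtain ⟨⟨a, b⟩, hab⟩ := c
  obtain ⟨⟨x, y⟩, hxy⟩ := d
  simp only [ends, Finset.disjoint_insert_left, Finset.mem_insert, Finset.mem_singleton,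
    Finset.disjoint_singleton_left] at h
  change a < b at hab
  change x < y at hxy
  simp only [crossing, separation, Fin.lt_def] at *
  simp only [Fin.ext_iff] at h
  split_ifs <;> first | rfl | omega

theorem prod_separation_pow_ind (c d : SkewVar N) :
    ∏ u, separation c u ^ ind (ends d) u = separation c d.1.1 * separation c d.1.2 := by
  have : ∀ u, separation c u ^ ind (ends d) u = if u ∈ ends d then separation c u else 1 := by
    intro u; unfold ind; split_ifs <;> simp
  simp_rw [this]
  rw [Finset.prod_ite_mem, Finset.univ_inter, ends, Finset.prod_pair d.2.ne]

/-- The parity of the number of edges crossing `c` thus depends only on the vertex degrees of `α`,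
not on how the vertices are matched. -/
theorem prod_separation_pow_vdeg (c : SkewVar N) (α : SkewVar N →₀ ℕ) :
    ∏ d, (separation c d.1.1 * separation c d.1.2) ^ α d = ∏ u, separation c u ^ vdeg α u := by
  simp_rw [vdeg, ← Finset.prod_pow_eq_pow_sum]
  rw [Finset.prod_comm]
  refine Finset.prod_congr rfl fun d _ => ?_
  rw [← prod_separation_pow_ind, ← Finset.prod_pow]
  exact Finset.prod_congr rfl fun u _ => by rw [← pow_mul, mul_comm]

/-- The sign that relates a matching of `U` to the one obtained by adding an edge. -/
def edgeSign (c : SkewVar N) (U : Finset (Fin N)) : ℤ := ∏ u, separation c u ^ ind U u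

theorem isUnit_edgeSign (c : SkewVar N) (U : Finset (Fin N)) : IsUnit (edgeSign c U) :=
  isUnit_prod_int _ _ fun u _ => (isUnit_separation c u).pow _

/-- The factor is the same for all perfect matchings of `U`; this is what makes contraction of a
Pfaffian by a variable a single smaller Pfaffian up to sign. -/
theorem crossingSign_single_add_of_disjoint {c : SkewVar N} {α : SkewVar N →₀ ℕ}
    {U : Finset (Fin N)} (hα : vdeg α = ind U) (hU : Disjoint (ends c) U) :
    crossingSign (Finsupp.single c 1 + α) = crossingSign α * edgeSign c U := by
  rw [crossingSign_single_add, edgeSign, ← hα, ← prod_separation_pow_vdeg]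
  congr 1
  refine Finset.prod_congr rfl fun d _ => ?_
  by_cases hd : α d = 0
  · simp [hd]
  rw [crossing_mul_crossing]
  refine hU.mono_right fun u hu => ?_
  have := mul_ind_le_vdeg α d u
  rw [hα] at this
  by_contra h0
  simp [ind, hu, h0, hd] at this

theorem vdeg_single_add_eq_ind_iff {c : SkewVar N} {α : SkewVar N →₀ ℕ} {T : Finset (Fin N)} :
    vdeg (Finsupp.single c 1 + α) = ind T ↔ ends c ⊆ T ∧ vdeg α = ind (T \ ends c) := by
  rw [vdeg_add, vdeg_single_one]
  constructor
  · intro h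
    have h' (u : Fin N) := congrFun h u
    simp only [Pi.add_apply, ind] at h'
    refine ⟨fun u hu => ?_, funext fun u => ?_⟩
    · have := h' u
      by_contra h0
      simp [hu, h0] at this
    · have := h' u
      simp only [ind, Finset.mem_sdiff]
      split_ifs at this ⊢ <;> simp_all
  · rintro ⟨h1, h2⟩
    rw [h2]
    ext u
    simp only [Pi.add_apply, ind, Finset.mem_sdiff]
    have := @h1 u
    split_ifs <;> simp_all

/-! ### The functionals attached to sets of vertices -/

variable (k : Type*) [Field k]

open Classical in
/-- The signed indicator function of the perfect matchings of a set of vertices. -/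
def weight (T : Finset (Fin N)) (α : SkewVar N →₀ ℕ) : k :=
  if vdeg α = ind T then (crossingSign α : k) else 0

/-- The signed sum of the coefficients at the perfect matchings of a set of vertices. -/
def functional (T : Finset (Fin N)) : MvPolynomial (SkewVar N) k →ₗ[k] k :=
  (basisMonomials (SkewVar N) k).constr k (weight k T)

variable {k}

theorem isUnit_cast {z : ℤ} (h : IsUnit z) : (z : k) ≠ 0 := by
  rcases Int.isUnit_iff.1 h with rfl | rfl <;> simp

theorem weight_ne_zero_iff {T : Finset (Fin N)} {α : SkewVar N →₀ ℕ} :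
    weight k T α ≠ 0 ↔ vdeg α = ind T := by
  unfold weight
  split_ifs with h <;> simp [h, isUnit_cast (k := k) (isUnit_crossingSign α)]

theorem functional_monomial (T : Finset (Fin N)) (α : SkewVar N →₀ ℕ) (a : k) :
    functional k T (monomial α a) = a * weight k T α := by
  have h : monomial α a = a • basisMonomials (SkewVar N) k α := by
    simp [coe_basisMonomials, smul_monomial]
  rw [h, map_smul, functional, Module.Basis.constr_basis, smul_eq_mul]

theorem functional_eq_sum (T : Finset (Fin N)) (f : MvPolynomial (SkewVar N) k) :
    functional k T f = ∑ α ∈ f.support, f.coeff α * weight k T α := by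
  conv_lhs => rw [f.as_sum, map_sum]
  exact Finset.sum_congr rfl fun α _ => functional_monomial _ _ _

theorem weight_single_add (T : Finset (Fin N)) (c : SkewVar N) (α : SkewVar N →₀ ℕ) :
    weight k T (Finsupp.single c 1 + α) =
      if ends c ⊆ T then (edgeSign c (T \ ends c) : k) * weight k (T \ ends c) α else 0 := by
  unfold weight
  simp only [vdeg_single_add_eq_ind_iff]
  by_cases h1 : ends c ⊆ T <;> by_cases h2 : vdeg α = ind (T \ ends c) <;> simp only [h1, h2,
    and_self, and_true, and_false, if_true, if_false, mul_zero]
  rw [crossingSign_single_add_of_disjoint h2 Finset.disjoint_sdiff, mul_comm]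
  push_cast
  rfl

/-- The perfect matchings of `T` through the edge `c` correspond to those of `T \ ends c`, with a
uniform change of sign. This is the rule through which multiplication enters all later arguments. -/
theorem functional_X_mul (T : Finset (Fin N)) (c : SkewVar N)
    (f : MvPolynomial (SkewVar N) k) :
    functional k T (X c * f) =
      if ends c ⊆ T then (edgeSign c (T \ ends c) : k) * functional k (T \ ends c) f else 0 := by
  induction f using MvPolynomial.induction_on' with
  | monomial α a =>
    rw [X, monomial_mul, one_mul, functional_monomial, functional_monomial, weight_single_add]
    split_ifs <;> ring
  | add p q hp hq =>
    rw [mul_add, map_add, hp, hq, map_add]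
    split_ifs <;> ring

theorem functional_one (T : Finset (Fin N)) :
    functional k T 1 = if T = ∅ then 1 else 0 := by
  rw [← C_1, ← monomial_zero', functional_monomial, one_mul, weight, vdeg_zero, crossingSign_zero]
  have : (0 : Fin N → ℕ) = ind ∅ := by ext u; simp [ind]
  rw [this]
  simp [ind_injective.eq_iff, eq_comm]

theorem functional_eq_zero_of_odd {T : Finset (Fin N)} (h : ¬ Even T.card)
    (f : MvPolynomial (SkewVar N) k) : functional k T f = 0 := by
  rw [functional_eq_sum]
  refine Finset.sum_eq_zero fun α _ => ?_
  rw [show weight k T α = 0 from ?_, mul_zero]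
  by_contra h0
  rw [← ne_eq, weight_ne_zero_iff] at h0
  apply h
  rw [← sum_ind, ← h0, sum_vdeg]
  exact even_two_mul _

/-- Any edge inside a nonempty set, as a variable. -/
theorem exists_edge {T : Finset (Fin N)} {a b : Fin N} (ha : a ∈ T) (hb : b ∈ T) (hab : a ≠ b) :
    ∃ c : SkewVar N, ends c = {a, b} ∧ ends c ⊆ T := by
  rcases lt_or_gt_of_ne hab with h | h
  · refine ⟨⟨(a, b), h⟩, rfl, ?_⟩
    simp [ends, Finset.insert_subset_iff, ha, hb]
  · refine ⟨⟨(b, a), h⟩, ?_, ?_⟩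
    · simp [ends, Finset.pair_comm]
    · simp [ends, Finset.insert_subset_iff, ha, hb]

/-- Every contraction of a Pfaffian is a multiple, possibly zero, of a Pfaffian. -/
theorem exists_functional_monomial_mul (β : SkewVar N →₀ ℕ) (T : Finset (Fin N)) :
    ∃ (s : k) (U : Finset (Fin N)), ∀ f : MvPolynomial (SkewVar N) k,
      functional k T (monomial β 1 * f) = s * functional k U f := by
  induction β using Finsupp.induction_linear generalizing T with
  | zero => exact ⟨1, T, fun f => by simp⟩
  | add β γ hβ hγ =>
    obtain ⟨s, U, h⟩ := hβ T
    obtain ⟨s', U', h'⟩ := hγ U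
    refine ⟨s * s', U', fun f => ?_⟩
    rw [mul_assoc, ← h', ← h, ← mul_assoc, monomial_mul, one_mul]
  | single c n =>
    induction n generalizing T with
    | zero => exact ⟨1, T, fun f => by simp⟩
    | succ n ih =>
      obtain ⟨s, U, h⟩ := ih (T \ ends c)
      by_cases hc : ends c ⊆ T
      · refine ⟨edgeSign c (T \ ends c) * s, U, fun f => ?_⟩
        rw [add_comm, Finsupp.single_add, ← one_mul (1 : k), ← monomial_mul, mul_assoc, ← X,
          functional_X_mul, if_pos hc, h, mul_assoc]
      · refine ⟨0, U, fun f => ?_⟩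
        rw [add_comm, Finsupp.single_add, ← one_mul (1 : k), ← monomial_mul, mul_assoc, ← X,
          functional_X_mul, if_neg hc, zero_mul]

/-- Contracting by a perfect matching of `T \ U` reaches the smaller set `U` with a nonzero scalar.
-/
theorem exists_functional_mul_eq {U T : Finset (Fin N)} (hUT : U ⊆ T)
    (hE : Even (T \ U).card) : ∃ (s : k) (β : SkewVar N →₀ ℕ), s ≠ 0 ∧
      ∀ f : MvPolynomial (SkewVar N) k,
        functional k T (monomial β 1 * f) = s * functional k U f := by
  generalize hn : (T \ U).card = n at hE
  induction n using Nat.strong_induction_on generalizing T with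
  | _ n ih =>
    rcases Nat.eq_zero_or_pos n with rfl | hpos
    · have : T = U := (Finset.sdiff_eq_empty_iff_subset.1 (Finset.card_eq_zero.1 hn)).antisymm hUT
      subst this
      exact ⟨1, 0, one_ne_zero, fun f => by simp⟩
    · have h1 : 1 < (T \ U).card := by
        obtain ⟨r, hr⟩ := hE
        omega
      obtain ⟨a, ha, b, hb, hab⟩ := Finset.one_lt_card.1 h1
      obtain ⟨c, -, hc⟩ := exists_edge ha hb hab
      have hcT : ends c ⊆ T := hc.trans Finset.sdiff_subset
      have hsd : (T \ ends c) \ U = (T \ U) \ ends c := by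
        ext u; simp only [Finset.mem_sdiff]; tauto
      have hcard : ((T \ ends c) \ U).card = n - 2 := by
        rw [hsd, Finset.card_sdiff_of_subset hc, hn, card_ends]
      obtain ⟨s, β, hs, h⟩ := ih (n - 2) (by omega) (T := T \ ends c) (fun u hu => by
        rw [Finset.mem_sdiff]
        exact ⟨hUT hu, fun h' => (Finset.mem_sdiff.1 (hc h')).2 hu⟩) hcard
        (by obtain ⟨r, hr⟩ := hE; exact ⟨r - 1, by omega⟩)
      refine ⟨edgeSign c (T \ ends c) * s, Finsupp.single c 1 + β,
        mul_ne_zero (isUnit_cast (isUnit_edgeSign _ _)) hs, fun f => ?_⟩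
      rw [← one_mul (1 : k), ← monomial_mul, mul_assoc, ← X, functional_X_mul, if_pos hcT, h,
        mul_assoc]

end Matchings

/-! ### The coefficients of Pfaffians -/

section Pfaffian

variable {N m : ℕ}

/-- The first element of the `i`-th block of size two. -/
def blockFst (i : Fin m) : Fin (2 * m) := ⟨2 * i, by omega⟩

/-- The second element of the `i`-th block of size two. -/
def blockSnd (i : Fin m) : Fin (2 * m) := ⟨2 * i + 1, by omega⟩

theorem exists_block (x : Fin (2 * m)) : ∃ i, x = blockFst i ∨ x = blockSnd i := by
  refine ⟨⟨x / 2, by omega⟩, ?_⟩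
  simp only [blockFst, blockSnd, Fin.ext_iff]
  omega

/-- Positions as pairs of a block and a position inside the block. -/
def blockEquiv (m : ℕ) : Fin m × Fin 2 ≃ Fin (2 * m) :=
  finProdFinEquiv.trans (finCongr (mul_comm m 2))

theorem blockEquiv_zero (i : Fin m) : blockEquiv m (i, 0) = blockFst i := by
  simp [blockEquiv, blockFst, Fin.ext_iff]

theorem blockEquiv_one (i : Fin m) : blockEquiv m (i, 1) = blockSnd i := by
  simp [blockEquiv, blockSnd, Fin.ext_iff, add_comm]

theorem prod_block {M : Type*} [CommMonoid M] (F : Fin (2 * m) → M) :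
    ∏ x, F x = ∏ i, F (blockFst i) * F (blockSnd i) := by
  rw [← (blockEquiv m).prod_comp, Fintype.prod_prod_type]
  simp [Fin.prod_univ_two, blockEquiv_zero, blockEquiv_one]

theorem sum_block {M : Type*} [AddCommMonoid M] (F : Fin (2 * m) → M) :
    ∑ x, F x = ∑ i, (F (blockFst i) + F (blockSnd i)) := by
  rw [← (blockEquiv m).sum_comp, Fintype.sum_prod_type]
  simp [Fin.sum_univ_two, blockEquiv_zero, blockEquiv_one]

/-- The permutations that index the terms of a Pfaffian. -/
def IsMatchingPerm (π : Equiv.Perm (Fin (2 * m))) : Prop :=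
  (∀ i, π (blockFst i) < π (blockSnd i)) ∧ StrictMono fun i => π (blockFst i)

open Classical in
theorem pfaffian_eq {R : Type*} [CommRing R] (A : Matrix (Fin (2 * m)) (Fin (2 * m)) R) :
    pfaffian A = ∑ π : Equiv.Perm (Fin (2 * m)) with IsMatchingPerm π,
      ((Equiv.Perm.sign π : ℤ) : R) * ∏ i, A (π (blockFst i)) (π (blockSnd i)) := by
  unfold pfaffian IsMatchingPerm
  congr!

variable (e : Fin (2 * m) ↪o Fin N) {π : Equiv.Perm (Fin (2 * m))} (hπ : IsMatchingPerm π)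

/-- The edges of the matching given by a permutation. -/
def edgeOf (i : Fin m) : SkewVar N :=
  ⟨(e (π (blockFst i)), e (π (blockSnd i))), e.strictMono (hπ.1 i)⟩

/-- The monomial of the matching given by a permutation. -/
def matchingMonomial : SkewVar N →₀ ℕ := ∑ i, Finsupp.single (edgeOf e hπ i) 1

theorem prod_genericSkew (k : Type*) [Field k] :
    ∏ i, (genericSkew k N).submatrix e e (π (blockFst i)) (π (blockSnd i)) =
      monomial (matchingMonomial e hπ) 1 := by
  rw [matchingMonomial, monomial_sum_one]
  refine Finset.prod_congr rfl fun i _ => ?_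
  have h : e (π (blockFst i)) < e (π (blockSnd i)) := e.strictMono (hπ.1 i)
  simp only [Matrix.submatrix_apply, genericSkew, dif_pos h]
  rfl

theorem vdeg_matchingMonomial :
    vdeg (matchingMonomial e hπ) = ind (Finset.univ.map e.toEmbedding) := by
  ext u
  rw [matchingMonomial, vdeg_sum, Finset.sum_apply]
  have h1 : ∀ i, vdeg (Finsupp.single (edgeOf e hπ i) 1) u =
      (if e (π (blockFst i)) = u then 1 else 0) + (if e (π (blockSnd i)) = u then 1 else 0) := by
    intro i
    have hlt : e (π (blockFst i)) ≠ e (π (blockSnd i)) := (e.strictMono (hπ.1 i)).ne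
    rw [vdeg_single_one]
    simp only [ind, mem_ends, edgeOf, eq_comm (a := u)]
    split_ifs with h1 h2 h3 <;> first | rfl | exact absurd (h2.trans h3.symm) hlt | tauto
  simp_rw [h1]
  rw [← sum_block (fun x => if e (π x) = u then 1 else 0),
    Equiv.sum_comp π (fun x => if e x = u then 1 else 0)]
  by_cases hu : ∃ x, e x = u
  · obtain ⟨x, rfl⟩ := hu
    simp [ind]
  · push Not at hu
    simp [ind, hu]

theorem prod_pow_sum_single (c : Fin m → SkewVar N) (f : SkewVar N → ℤ) :
    ∏ d, f d ^ (∑ i, Finsupp.single (c i) 1 : SkewVar N →₀ ℕ) d = ∏ i, f (c i) := by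
  simp_rw [Finsupp.finsetSum_apply, ← Finset.prod_pow_eq_pow_sum]
  rw [Finset.prod_comm]
  exact Finset.prod_congr rfl fun i _ => prod_pow_single f (c i)

theorem crossingSign_matchingMonomial : crossingSign (matchingMonomial e hπ) =
    ∏ i, ∏ j, crossing (edgeOf e hπ i) (edgeOf e hπ j) := by
  rw [crossingSign, matchingMonomial]
  rw [← prod_pow_sum_single (edgeOf e hπ) fun c => ∏ j, crossing c (edgeOf e hπ j)]
  refine Finset.prod_congr rfl fun c _ => ?_
  rw [← prod_pow_sum_single (edgeOf e hπ), ← Finset.prod_pow]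
  exact Finset.prod_congr rfl fun d _ => by rw [← pow_mul, mul_comm]

/-- Inversions of `π` are counted by pairs of blocks `i < j`. As the first entries increase, only
the second entry of block `i` can exceed an entry of block `j`: it exceeds none if the edges are
side by side, one if they cross, and two if they are nested. Hence inversions and crossings have the
same parity. -/
theorem sign_eq_crossingSign :
    (Equiv.Perm.sign π : ℤ) = crossingSign (matchingMonomial e hπ) := by
  rw [crossingSign_matchingMonomial, Equiv.Perm.sign_eq_prod_prod_Ioi]
  have h : ∀ x : Fin (2 * m), ∏ y ∈ Finset.Ioi x, (if π x < π y then (1 : ℤˣ) else -1) =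
      ∏ y, if x < y then (if π x < π y then (1 : ℤˣ) else -1) else 1 := by
    intro x
    rw [← Finset.prod_filter]
    congr 1
    ext y; simp
  simp_rw [h, prod_block (m := m), ← Finset.prod_mul_distrib]
  push_cast
  refine Finset.prod_congr rfl fun i _ => Finset.prod_congr rfl fun j _ => ?_
  have hi : π (blockFst i) < π (blockSnd i) := hπ.1 i
  have hj : π (blockFst j) < π (blockSnd j) := hπ.1 j
  have e1 : blockFst i < blockFst j ↔ i < j := by
    rw [Fin.lt_def, Fin.lt_def]; simp only [blockFst]; omega
  have e2 : blockSnd i < blockSnd j ↔ i < j := by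
    rw [Fin.lt_def, Fin.lt_def]; simp only [blockSnd]; omega
  have e3 : blockFst i < blockSnd j ↔ i ≤ j := by
    rw [Fin.lt_def, Fin.le_def]; simp only [blockFst, blockSnd]; omega
  have e4 : blockSnd i < blockFst j ↔ i < j := by
    rw [Fin.lt_def, Fin.lt_def]; simp only [blockFst, blockSnd]; omega
  simp only [e1, e2, e3, e4, crossing, edgeOf, e.lt_iff_lt]
  have hne : π (blockSnd i) ≠ π (blockFst j) := by
    intro h0
    have := π.injective h0
    simp only [blockFst, blockSnd, Fin.ext_iff] at this
    omega
  rcases lt_trichotomy i j with hij | rfl | hij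
  · have hm : π (blockFst i) < π (blockFst j) := hπ.2 hij
    simp only [hij, hij.le, hm, hm.trans hj, if_true, true_and]
    rcases lt_or_gt_of_ne hne with h1 | h1
    · simp [h1, h1.trans hj, not_lt.2 h1.le]
    · simp only [h1, not_lt.2 h1.le, true_and, if_false]
      have hne' : π (blockSnd i) ≠ π (blockSnd j) := by
        intro h0
        have := π.injective h0
        simp only [blockSnd, Fin.ext_iff] at this
        omega
      rcases lt_or_gt_of_ne hne' with h2 | h2
      · simp [h2]
      · simp [not_lt.2 h2.le]
  · simp [hi]
  · have hm : π (blockFst j) < π (blockFst i) := hπ.2 hij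
    simp [not_lt.2 hij.le, not_le.2 hij, not_lt.2 hm.le]

theorem matchingMonomial_apply_ne_zero_iff (d : SkewVar N) :
    matchingMonomial e hπ d ≠ 0 ↔ d ∈ Set.range (edgeOf e hπ) := by
  rw [matchingMonomial, Finsupp.finsetSum_apply, ne_eq, Finset.sum_eq_zero_iff]
  simp [Finsupp.single_apply]

/-- The monomial gives the set of edges, and the increasing order of their first ends then fixes the
position of each edge. -/
theorem matchingMonomial_injective {π' : Equiv.Perm (Fin (2 * m))} (hπ' : IsMatchingPerm π')
    (h : matchingMonomial e hπ = matchingMonomial e hπ') : π = π' := by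
  have hr : Set.range (edgeOf e hπ) = Set.range (edgeOf e hπ') := by
    ext d
    rw [← matchingMonomial_apply_ne_zero_iff, h, matchingMonomial_apply_ne_zero_iff]
  have hm : StrictMono fun i => (edgeOf e hπ i).1.1 := fun i j hij => e.strictMono (hπ.2 hij)
  have hm' : StrictMono fun i => (edgeOf e hπ' i).1.1 := fun i j hij => e.strictMono (hπ'.2 hij)
  have hf : (fun i => (edgeOf e hπ i).1.1) = fun i => (edgeOf e hπ' i).1.1 := by
    rw [← hm.range_inj hm']
    have := congrArg (fun s => (fun c : SkewVar N => c.1.1) '' s) hr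
    rwa [← Set.range_comp, ← Set.range_comp] at this
  have hc : ∀ i, edgeOf e hπ i = edgeOf e hπ' i := by
    intro i
    obtain ⟨j, hj⟩ : edgeOf e hπ' i ∈ Set.range (edgeOf e hπ) := hr ▸ Set.mem_range_self i
    have h1 : (edgeOf e hπ j).1.1 = (edgeOf e hπ i).1.1 := by rw [hj, congrFun hf i]
    rw [← hj, hm.injective h1]
  ext1 x
  obtain ⟨i, rfl | rfl⟩ := exists_block x
  · exact e.injective (congrArg (fun c : SkewVar N => c.1.1) (hc i))
  · exact e.injective (congrArg (fun c : SkewVar N => c.1.2) (hc i))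


/-! ### Every perfect matching comes from a permutation in the Pfaffian. -/

section Existence

variable {T : Finset (Fin N)} {α : SkewVar N →₀ ℕ}

theorem apply_le_one (hα : vdeg α = ind T) (c : SkewVar N) : α c ≤ 1 := by
  have h := mul_ind_le_vdeg α c c.1.1
  rw [hα] at h
  simp only [ind, mem_ends, true_or, if_true, mul_one] at h
  split_ifs at h <;> omega

theorem mem_of_mem_ends (hα : vdeg α = ind T) {c : SkewVar N} (hc : α c ≠ 0) {u : Fin N}
    (hu : u ∈ ends c) : u ∈ T := by
  have h := mul_ind_le_vdeg α c u
  rw [hα] at h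
  by_contra h0
  simp [ind, hu, h0, hc] at h

theorem two_le_vdeg {c d : SkewVar N} (hcd : c ≠ d) (hc : α c ≠ 0) (hd : α d ≠ 0) {u : Fin N}
    (hu : u ∈ ends c) (hu' : u ∈ ends d) : 2 ≤ vdeg α u := by
  have h : ∑ x ∈ {c, d}, α x * ind (ends x) u ≤ vdeg α u :=
    Finset.sum_le_sum_of_subset (Finset.subset_univ _)
  rw [Finset.sum_pair hcd] at h
  simp only [ind, hu, hu', if_true, mul_one] at h
  omega

theorem eq_of_mem_ends (hα : vdeg α = ind T) {c d : SkewVar N} (hc : α c ≠ 0) (hd : α d ≠ 0)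
    {u : Fin N} (hu : u ∈ ends c) (hu' : u ∈ ends d) : c = d := by
  by_contra hcd
  have h := two_le_vdeg hcd hc hd hu hu'
  rw [hα, ind] at h
  split_ifs at h <;> omega

theorem eq_sum_support (hα : vdeg α = ind T) : α = ∑ d ∈ α.support, Finsupp.single d 1 := by
  conv_lhs => rw [← α.sum_single]
  refine Finset.sum_congr rfl fun d hd => ?_
  have := apply_le_one hα d
  rw [Finsupp.mem_support_iff] at hd
  rw [show α d = 1 by omega]

theorem two_mul_card_support (hα : vdeg α = ind T) : 2 * α.support.card = T.card := by
  rw [← sum_ind, ← hα, sum_vdeg, Finsupp.degree_apply, Finset.card_eq_sum_ones]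
  congr 1
  refine Finset.sum_congr rfl fun d hd => ?_
  have := apply_le_one hα d
  rw [Finsupp.mem_support_iff] at hd
  omega

/-- The permutation is read off by listing the edges in increasing order of their smaller ends. -/
theorem exists_matchingMonomial_eq
    (hα : vdeg α = ind (Finset.univ.map e.toEmbedding)) :
    ∃ (π : Equiv.Perm (Fin (2 * m))) (hπ : IsMatchingPerm π), matchingMonomial e hπ = α := by
  classical
  have hcard : α.support.card = m := by
    have := two_mul_card_support hα
    simp only [Finset.card_map, Finset.card_univ, Fintype.card_fin] at this
    omega
  have hinj : Set.InjOn (fun c : SkewVar N => c.1.1) α.support := by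
    intro c hc d hd hcd
    simp only [Finset.mem_coe, Finsupp.mem_support_iff] at hc hd
    exact eq_of_mem_ends hα hc hd (mem_ends.2 (Or.inl rfl)) (mem_ends.2 (Or.inl hcd))
  have hF : (α.support.image fun c => c.1.1).card = m := by
    rw [Finset.card_image_of_injOn hinj, hcard]
  set o := (α.support.image fun c => c.1.1).orderEmbOfFin hF
  have hc : ∀ i, ∃ c : SkewVar N, α c ≠ 0 ∧ c.1.1 = o i := by
    intro i
    obtain ⟨c, hc, h⟩ := Finset.mem_image.1 (Finset.orderEmbOfFin_mem _ hF i)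
    exact ⟨c, Finsupp.mem_support_iff.1 hc, h⟩
  choose c hc hco using hc
  have hT : ∀ i, ∀ u ∈ ends (c i), ∃ x, e x = u := by
    intro i u hu
    simpa using mem_of_mem_ends hα (hc i) hu
  choose p hp using fun i => hT i _ (mem_ends.2 (Or.inl rfl))
  choose q hq using fun i => hT i _ (mem_ends.2 (Or.inr rfl))
  have hsurj_c : ∀ d, α d ≠ 0 → ∃ i, c i = d := by
    intro d hd
    obtain ⟨i, hi⟩ : d.1.1 ∈ Set.range o := by
      rw [Finset.range_orderEmbOfFin]
      exact Finset.mem_coe.2 (Finset.mem_image_of_mem _ (Finsupp.mem_support_iff.2 hd))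
    refine ⟨i, eq_of_mem_ends hα (hc i) hd (mem_ends.2 (Or.inl rfl)) (mem_ends.2 (Or.inl ?_))⟩
    rw [hco, hi]
  let P : Fin (2 * m) → Fin (2 * m) := fun x =>
    if ((blockEquiv m).symm x).2 = 0 then p ((blockEquiv m).symm x).1
      else q ((blockEquiv m).symm x).1
  have hP0 : ∀ i, P (blockFst i) = p i := by
    intro i
    simp [P, ← blockEquiv_zero]
  have hP1 : ∀ i, P (blockSnd i) = q i := by
    intro i
    simp [P, ← blockEquiv_one]
  -- Every vertex is covered by an edge of the matching; on a finite set surjectivity already gives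
  -- a permutation.
  have hPs : Function.Surjective P := by
    intro x
    obtain ⟨d, hd, hx⟩ : ∃ d, α d ≠ 0 ∧ e x ∈ ends d := by
      apply exists_mem_ends_of_vdeg_ne_zero
      simp [hα, ind]
    obtain ⟨i, rfl⟩ := hsurj_c d hd
    rcases mem_ends.1 hx with h | h
    · exact ⟨blockFst i, by rw [hP0]; exact e.injective ((hp i).trans h.symm)⟩
    · exact ⟨blockSnd i, by rw [hP1]; exact e.injective ((hq i).trans h.symm)⟩
  let π : Equiv.Perm (Fin (2 * m)) :=
    Equiv.ofBijective P ⟨Finite.injective_iff_surjective.2 hPs, hPs⟩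
  have h0 : ∀ i, π (blockFst i) = p i := hP0
  have h1 : ∀ i, π (blockSnd i) = q i := hP1
  have hπ : IsMatchingPerm π := by
    refine ⟨fun i => ?_, fun i j hij => ?_⟩
    · rw [h0, h1, ← e.lt_iff_lt, hp, hq]
      exact (c i).2
    · change π _ < π _
      rw [h0, h0, ← e.lt_iff_lt, hp, hp, hco, hco]
      exact o.strictMono hij
  refine ⟨π, hπ, ?_⟩
  have hec : edgeOf e hπ = c := by
    ext1 i
    refine Subtype.ext (Prod.ext ?_ ?_)
    · change e (π (blockFst i)) = _
      rw [h0, hp]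
    · change e (π (blockSnd i)) = _
      rw [h1, hq]
  have hcinj : Function.Injective c := by
    intro i j hij
    apply o.injective
    rw [← hco, ← hco, hij]
  have hs : α.support = Finset.univ.image c := by
    ext d
    simp only [Finsupp.mem_support_iff, Finset.mem_image, Finset.mem_univ, true_and]
    exact ⟨hsurj_c d, by rintro ⟨i, rfl⟩; exact hc i⟩
  rw [matchingMonomial, hec, eq_sum_support hα, hs, Finset.sum_image hcinj.injOn]

end Existence

/-- Distinct terms of the Pfaffian have distinct monomials, so no coefficients merge and the
characteristic plays no role. -/
theorem coeff_pfaffian (k : Type*) [Field k] (α : SkewVar N →₀ ℕ) :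
    coeff α (pfaffian ((genericSkew k N).submatrix e e)) =
      weight k (Finset.univ.map e.toEmbedding) α := by
  classical
  have hterm : ∀ π : Equiv.Perm (Fin (2 * m)), ∀ hπ : IsMatchingPerm π,
      coeff α (((Equiv.Perm.sign π : ℤ) : MvPolynomial (SkewVar N) k) *
        ∏ i, (genericSkew k N).submatrix e e (π (blockFst i)) (π (blockSnd i))) =
      if matchingMonomial e hπ = α then
        ((crossingSign (matchingMonomial e hπ) : ℤ) : k) else 0 := by
    intro π hπ
    rw [prod_genericSkew e hπ, sign_eq_crossingSign e hπ,
      ← map_intCast (C (R := k) (σ := SkewVar N)),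
      coeff_C_mul, coeff_monomial]
    simp
  rw [pfaffian_eq, coeff_sum, weight]
  split_ifs with h
  · obtain ⟨π, hπ, rfl⟩ := exists_matchingMonomial_eq e h
    rw [Finset.sum_eq_single_of_mem π (by simpa using hπ), hterm π hπ, if_pos rfl]
    intro π' hπ' hne
    have hπ' : IsMatchingPerm π' := by simpa using hπ'
    rw [hterm π' hπ', if_neg]
    exact fun h0 => hne (matchingMonomial_injective e hπ' hπ h0)
  · refine Finset.sum_eq_zero fun π hπ => ?_
    have hπ : IsMatchingPerm π := by simpa using hπ
    rw [hterm π hπ, if_neg]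
    rintro rfl
    exact h (vdeg_matchingMonomial e hπ)

end Pfaffian

/-! ### The apolar ideal -/

section Apolar

variable {N : ℕ} {k : Type*} [Field k]

/-- The coefficients of an element of the graded dual. -/
def dualCoeff {σ : Type*} (β : σ →₀ ℕ) : GradedDual σ k →ₗ[k] k :=
  (Finsupp.lapply β : ((σ →₀ ℕ) →₀ k) →ₗ[k] k)

theorem GradedDual.ext {σ : Type*} {F G : GradedDual σ k}
    (h : ∀ β, dualCoeff β F = dualCoeff β G) : F = G := Finsupp.ext h

theorem dualCoeff_ofPolynomial {σ : Type*} (β : σ →₀ ℕ) (f : MvPolynomial σ k) :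
    dualCoeff β (GradedDual.ofPolynomial f) = coeff β f := by
  classical
  have h : ∀ α, dualCoeff β (GradedDual.X k α) = if α = β then 1 else 0 := fun α =>
    Finsupp.single_apply
  rw [GradedDual.ofPolynomial, map_sum]
  simp only [map_smul, h, smul_eq_mul, mul_ite, mul_one, mul_zero, Finset.sum_ite_eq',
    mem_support_iff]
  split_ifs with h0
  · rfl
  · exact (not_not.1 h0).symm

theorem dualCoeff_monomial_smul {σ : Type*} (α β : σ →₀ ℕ) (a : k) (F : GradedDual σ k) :
    dualCoeff β (monomial α a • F) = a * dualCoeff (α + β) F := by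
  have h : GradedDual.contraction (monomial α a) = a • GradedDual.contractMonomial (k := k) α := by
    rw [← single_eq_monomial]
    exact AddMonoidAlgebra.lift_single _ _ _
  rw [GradedDual.smul_def, h]
  rfl

/-- Contraction is adjoint to multiplication. -/
theorem dualCoeff_smul_ofPolynomial_pfaffian {m : ℕ} (e : Fin (2 * m) ↪o Fin N)
    (f : MvPolynomial (SkewVar N) k) (β : SkewVar N →₀ ℕ) :
    dualCoeff β (f • GradedDual.ofPolynomial (pfaffian ((genericSkew k N).submatrix e e))) =
      functional k (Finset.univ.map e.toEmbedding) (monomial β 1 * f) := by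
  induction f using MvPolynomial.induction_on' with
  | monomial α a =>
    rw [dualCoeff_monomial_smul, dualCoeff_ofPolynomial, coeff_pfaffian, monomial_mul, one_mul,
      functional_monomial, add_comm]
  | add p q hp hq => rw [add_smul, map_add, hp, hq, mul_add, map_add]

/-- The Pfaffians of maximal even size generate those of all even subsets by contraction, because an
even `U` extends to a set of size `2 * (N / 2)`. The functionals of odd sets vanish identically.
Conversely, the coefficients of `f` contracted with a generator are multiples of values of
functionals at `f`. -/
theorem mem_apolarIdeal_iff {f : MvPolynomial (SkewVar N) k} :
    f ∈ apolarIdeal k N ↔ ∀ T, functional k T f = 0 := by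
  rw [apolarIdeal, pfaffianModule, Submodule.mem_annihilator_span]
  constructor
  · intro h U
    by_cases hU : Even U.card
    · obtain ⟨T, hUT, -, hT⟩ : ∃ T, U ⊆ T ∧ T ⊆ Finset.univ ∧ T.card = 2 * (N / 2) := by
        refine Finset.exists_subsuperset_card_eq (Finset.subset_univ U) ?_ ?_
        · have := Finset.card_le_univ U
          rw [Fintype.card_fin] at this
          obtain ⟨r, hr⟩ := hU
          omega
        · rw [Finset.card_univ, Fintype.card_fin]
          omega
      have hE : Even (T \ U).card := by
        rw [Finset.card_sdiff_of_subset hUT, hT]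
        obtain ⟨r, hr⟩ := hU
        exact ⟨N / 2 - r, by omega⟩
      obtain ⟨s, β, hs, hβ⟩ := exists_functional_mul_eq (k := k) hUT hE
      have hm : Finset.univ.map (T.orderEmbOfFin hT).toEmbedding = T := by
        ext u
        rw [← Finset.mem_coe, ← Finset.mem_coe, ← Finset.range_orderEmbOfFin T hT]
        simp
      have h0 := h ⟨_, _, ⟨T.orderEmbOfFin hT, rfl⟩, rfl⟩
      have h1 := dualCoeff_smul_ofPolynomial_pfaffian (T.orderEmbOfFin hT) f β
      rw [hm, hβ] at h1
      simp only at h0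
      rw [h0, map_zero] at h1
      exact (mul_eq_zero.1 h1.symm).resolve_left hs
    · exact functional_eq_zero_of_odd hU f
  · rintro h ⟨_, _, ⟨e, rfl⟩, rfl⟩
    refine GradedDual.ext fun β => ?_
    simp only
    rw [dualCoeff_smul_ofPolynomial_pfaffian, map_zero]
    obtain ⟨s, U, hs⟩ := exists_functional_monomial_mul (k := k) β (Finset.univ.map e.toEmbedding)
    rw [hs, h, mul_zero]

end Apolar

/-! ### The quadrics in the apolar ideal -/

section Quadrics

variable {N : ℕ} {k : Type*} [Field k]

theorem genericSkew_of_lt {a b : Fin N} (h : a < b) : genericSkew k N a b = X ⟨(a, b), h⟩ :=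
  dif_pos h

theorem genericSkew_swap (a b : Fin N) : genericSkew k N b a = -genericSkew k N a b := by
  unfold genericSkew
  rcases lt_trichotomy a b with h | rfl | h
  · simp [h, not_lt.2 h.le]
  · simp
  · simp [h, not_lt.2 h.le]

theorem X_mul_X_eq (c d : SkewVar N) :
    (X c * X d : MvPolynomial (SkewVar N) k) =
      monomial (Finsupp.single c 1 + Finsupp.single d 1) 1 := by
  rw [X, X, monomial_mul, one_mul]

theorem exists_genericSkew_eq {a b : Fin N} (hab : a ≠ b) :
    ∃ (c : SkewVar N) (s : k), ends c = {a, b} ∧ s ≠ 0 ∧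
      genericSkew k N a b = monomial (Finsupp.single c 1) s := by
  rcases lt_or_gt_of_ne hab with h | h
  · exact ⟨⟨(a, b), h⟩, 1, rfl, one_ne_zero, genericSkew_of_lt h⟩
  · refine ⟨⟨(b, a), h⟩, -1, Finset.pair_comm _ _, neg_ne_zero.2 one_ne_zero, ?_⟩
    rw [genericSkew_swap, genericSkew_of_lt h, X, map_neg]

theorem ends_injective : Function.Injective (ends (N := N)) := by
  rintro ⟨⟨a, b⟩, h⟩ ⟨⟨a', b'⟩, h'⟩ he
  change a < b at h
  change a' < b' at h'
  have h1 (u : Fin N) := Finset.ext_iff.1 he u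
  simp only [mem_ends] at h1
  have ha := (h1 a).1 (Or.inl rfl)
  have hb := (h1 b).1 (Or.inr rfl)
  have ha' := (h1 a').2 (Or.inl rfl)
  simp only [Subtype.mk.injEq, Prod.mk.injEq, Fin.ext_iff] at *
  omega

/-- The quadric relation attached to four indices in any order. -/
def exchange (k : Type*) [Field k] (p q r s : Fin N) : MvPolynomial (SkewVar N) k :=
  genericSkew k N p q * genericSkew k N r s + genericSkew k N p r * genericSkew k N q s

theorem exchange_swap_mid (p q r s : Fin N) : exchange k p r q s = exchange k p q r s :=
  add_comm _ _

theorem exchange_swap_swap (p q r s : Fin N) : exchange k q p s r = exchange k p q r s := by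
  unfold exchange
  rw [genericSkew_swap p q, genericSkew_swap r s]
  ring

theorem exchange_mem_of_lt {p q r s : Fin N} (h1 : p < q) (h2 : q < r) (h3 : p < s)
    (h4 : s ≠ q) (h5 : s ≠ r) :
    exchange k p q r s ∈ quadrics k N ∨ -exchange k p q r s ∈ quadrics k N := by
  rcases lt_or_gt_of_ne h5 with h5 | h5
  · rcases lt_or_gt_of_ne h4 with h4 | h4
    · right; right
      refine ⟨p, s, q, r, h3, h4, h2, Or.inr (Or.inl ?_)⟩
      rw [exchange, genericSkew_swap s q, genericSkew_swap s r]; ring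
    · right; right
      refine ⟨p, q, s, r, h1, h4, h5, Or.inr (Or.inr ?_)⟩
      rw [exchange, genericSkew_swap s r]; ring_nf; rfl
  · exact Or.inl (Or.inr ⟨p, q, r, s, h1, h2, h5, Or.inl rfl⟩)

theorem exchange_mem_of_lt_min {p q r s : Fin N} (h1 : p < q) (h2 : p < r) (h3 : p < s)
    (h4 : q ≠ r) (h5 : q ≠ s) (h6 : r ≠ s) :
    exchange k p q r s ∈ quadrics k N ∨ -exchange k p q r s ∈ quadrics k N := by
  rcases lt_or_gt_of_ne h4 with h4 | h4
  · exact exchange_mem_of_lt h1 h4 h3 h5.symm h6.symm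
  · rw [← exchange_swap_mid]
    exact exchange_mem_of_lt h2 h4 h3 h6.symm h5.symm

/-- In terms of the skew-symmetric entries one formula, with a plus sign, covers all three relations
in every ordering of the indices. Its symmetries act transitively on the four positions, so the
smallest index may be moved to the first one. -/
theorem exchange_mem {p q r s : Fin N} (h1 : p ≠ q) (h2 : p ≠ r) (h3 : p ≠ s)
    (h4 : q ≠ r) (h5 : q ≠ s) (h6 : r ≠ s) :
    exchange k p q r s ∈ quadrics k N ∨ -exchange k p q r s ∈ quadrics k N := by
  have e1 : exchange k q p s r = exchange k p q r s := exchange_swap_swap p q r s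
  have e2 : exchange k r p s q = exchange k p q r s :=
    (exchange_swap_swap p r q s).trans (exchange_swap_mid p q r s)
  have e3 : exchange k s r q p = exchange k p q r s :=
    (exchange_swap_swap r s p q).trans ((exchange_swap_mid r p s q).trans e2)
  have hmin : (p < q ∧ p < r ∧ p < s) ∨ (q < p ∧ q < s ∧ q < r) ∨ (r < p ∧ r < s ∧ r < q) ∨
      (s < r ∧ s < q ∧ s < p) := by
    simp only [Fin.lt_def, ne_eq, Fin.ext_iff] at *
    omega
  rcases hmin with h | h | h | h
  · exact exchange_mem_of_lt_min h.1 h.2.1 h.2.2 h4 h5 h6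
  · rw [← e1]
    exact exchange_mem_of_lt_min h.1 h.2.1 h.2.2 h3 h2 h6.symm
  · rw [← e2]
    exact exchange_mem_of_lt_min h.1 h.2.1 h.2.2 h3 h1 h5.symm
  · rw [← e3]
    exact exchange_mem_of_lt_min h.1 h.2.1 h.2.2 h4.symm h2.symm h1.symm

theorem X_mul_X_mem_quadrics {c d : SkewVar N} (hcd : c ≠ d) {u : Fin N} (hc : u ∈ ends c)
    (hd : u ∈ ends d) : (X c * X d : MvPolynomial (SkewVar N) k) ∈ quadrics k N := by
  obtain ⟨⟨a, b⟩, h⟩ := c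
  obtain ⟨⟨a', b'⟩, h'⟩ := d
  change a < b at h
  change a' < b' at h'
  simp only [mem_ends] at hc hd
  have hne : ¬(a = a' ∧ b = b') := by
    rintro ⟨rfl, rfl⟩; exact hcd rfl
  have key : ∀ p q r : Fin N, ∀ (h1 : p < q) (h2 : q < r),
      (X ⟨(p, q), h1⟩ * X ⟨(p, r), h1.trans h2⟩ : MvPolynomial (SkewVar N) k) ∈ quadrics k N ∧
      (X ⟨(p, q), h1⟩ * X ⟨(q, r), h2⟩ : MvPolynomial (SkewVar N) k) ∈ quadrics k N ∧
      (X ⟨(p, r), h1.trans h2⟩ * X ⟨(q, r), h2⟩ : MvPolynomial (SkewVar N) k) ∈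
        quadrics k N := by
    intro p q r h1 h2
    refine ⟨Or.inl (Or.inr ⟨p, q, r, h1, h2, Or.inl ?_⟩),
      Or.inl (Or.inr ⟨p, q, r, h1, h2, Or.inr (Or.inl ?_)⟩),
      Or.inl (Or.inr ⟨p, q, r, h1, h2, Or.inr (Or.inr ?_)⟩)⟩ <;>
    simp only [genericSkew_of_lt h1, genericSkew_of_lt h2, genericSkew_of_lt (h1.trans h2),
      Set.mem_singleton_iff]
  rcases hc with rfl | rfl <;> rcases hd with rfl | rfl
  · rcases lt_trichotomy b b' with hb | rfl | hb
    · exact (key u b b' h hb).1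
    · exact absurd ⟨rfl, rfl⟩ hne
    · rw [mul_comm]; exact (key u b' b h' hb).1
  · rw [mul_comm]; exact (key a' u b h' h).2.1
  · exact (key a u b' h h').2.1
  · rcases lt_trichotomy a a' with ha | rfl | ha
    · exact (key a a' u ha h').2.2
    · exact absurd ⟨rfl, rfl⟩ hne
    · rw [mul_comm]; exact (key a' a u ha h).2.2

theorem X_sq_mem_quadrics (c : SkewVar N) :
    (X c ^ 2 : MvPolynomial (SkewVar N) k) ∈ quadrics k N :=
  Or.inl (Or.inl ⟨c.1.1, c.1.2, c.2, by rw [genericSkew_of_lt c.2]⟩)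

theorem functional_X_mul_X_of_not_disjoint {c d : SkewVar N} {u : Fin N} (hc : u ∈ ends c)
    (hd : u ∈ ends d) (T : Finset (Fin N)) : functional k T (X c * X d) = 0 := by
  rw [functional_X_mul]
  split_ifs with h
  · rw [← mul_one (X d), functional_X_mul, if_neg, mul_zero]
    intro h'
    exact (Finset.mem_sdiff.1 (h' hd)).2 hc
  · rfl

open Classical in
theorem functional_X_mul_X {c d : SkewVar N} (T : Finset (Fin N)) :
    functional k T (X c * X d) =
      if ind (ends c) + ind (ends d) = ind T then ((crossing c d * crossing d c : ℤ) : k)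
        else 0 := by
  rw [X_mul_X_eq, functional_monomial, weight, vdeg_add, vdeg_single_one, vdeg_single_one,
    crossingSign_single_add, prod_pow_single, one_mul]
  rw [← add_zero (Finsupp.single d 1), crossingSign_single_add, crossingSign_zero]
  simp

theorem quadrics_subset_apolarIdeal :
    quadrics k N ⊆ (apolarIdeal k N : Set (MvPolynomial (SkewVar N) k)) := by
  intro f hf
  rw [SetLike.mem_coe, mem_apolarIdeal_iff]
  intro T
  rcases hf with (⟨a, b, h, rfl⟩ | ⟨a, b, c, h1, h2, hf⟩) | ⟨a, b, c, d, h1, h2, h3, hf⟩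
  · rw [genericSkew_of_lt h, sq]
    exact functional_X_mul_X_of_not_disjoint (u := a) (by simp [mem_ends]) (by simp [mem_ends]) T
  · simp only [genericSkew_of_lt h1, genericSkew_of_lt h2, genericSkew_of_lt (h1.trans h2),
      Set.mem_insert_iff, Set.mem_singleton_iff] at hf
    rcases hf with rfl | rfl | rfl
    · exact functional_X_mul_X_of_not_disjoint (u := a) (by simp [mem_ends]) (by simp [mem_ends]) T
    · exact functional_X_mul_X_of_not_disjoint (u := b) (by simp [mem_ends]) (by simp [mem_ends]) T
    · exact functional_X_mul_X_of_not_disjoint (u := c) (by simp [mem_ends]) (by simp [mem_ends]) T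
  · have h12 := h1.trans h2
    have h23 := h2.trans h3
    have h123 := h12.trans h3
    have e1 : functional k T (X ⟨(a, b), h1⟩ * X ⟨(c, d), h3⟩) =
        functional k T (X ⟨(a, d), h123⟩ * X ⟨(b, c), h2⟩) := by
      rw [functional_X_mul_X, functional_X_mul_X]
      congr 1
      · congr 1
        ext u
        simp only [Pi.add_apply, ind, mem_ends]
        have := h1.ne; have := h2.ne; have := h3.ne; have := h12.ne; have := h23.ne; have := h123.ne
        split_ifs <;> grind
      · simp [crossing, not_lt.2 h1.le, not_lt.2 h2.le, not_lt.2 h3.le, not_lt.2 h12.le,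
        not_lt.2 h23.le]
    have e2 : functional k T (X ⟨(a, c), h12⟩ * X ⟨(b, d), h23⟩) =
        -functional k T (X ⟨(a, b), h1⟩ * X ⟨(c, d), h3⟩) := by
      rw [functional_X_mul_X, functional_X_mul_X]
      have : ind (ends (⟨(a, c), h12⟩ : SkewVar N)) + ind (ends ⟨(b, d), h23⟩) =
          ind (ends (⟨(a, b), h1⟩ : SkewVar N)) + ind (ends ⟨(c, d), h3⟩) := by
        ext u
        simp only [Pi.add_apply, ind, mem_ends]
        have := h1.ne; have := h2.ne; have := h3.ne; have := h12.ne; have := h23.ne; have := h123.ne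
        split_ifs <;> grind
      rw [this]
      split_ifs
      · simp [crossing, not_lt.2 h1.le, not_lt.2 h2.le, not_lt.2 h3.le, not_lt.2 h12.le,
        not_lt.2 h23.le, h1, h2, h3]
      · simp
    simp only [quadrupleSet, genericSkew_of_lt h1, genericSkew_of_lt h2, genericSkew_of_lt h3,
      genericSkew_of_lt h12, genericSkew_of_lt h23, genericSkew_of_lt h123,
      Set.mem_insert_iff, Set.mem_singleton_iff] at hf
    rcases hf with rfl | rfl | rfl
    · rw [map_add, e2, add_neg_cancel]
    · rw [map_add, e2, e1, add_neg_cancel]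
    · rw [map_sub, e1, sub_self]

end Quadrics

/-! ### The Gröbner basis property -/

section Groebner

open scoped MonomialOrder

/-- Here `e` is the lowest variable at which `α` and `β` differ. Variables with larger exponent in
`α` lie above it, so a product containing `e` is revlex-smaller than a product of two of them,
whatever the other factor `f` is. -/
theorem exists_exchange_lt {σ : Type*} [LinearOrder σ] [Finite σ] {α β : σ →₀ ℕ}
    (h : β ≺[degRevLex σ] α) (hd : β.degree = α.degree) :
    ∃ e, α e < β e ∧ ∀ c d f, β c < α c → β d < α d →
      Finsupp.single e 1 + Finsupp.single f 1 ≺[degRevLex σ]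
        Finsupp.single c 1 + Finsupp.single d 1 := by
  rw [degRevLex_lt_iff] at h
  obtain ⟨-, e, he, hlt⟩ := h.resolve_left hd.not_lt
  refine ⟨e, hlt, fun c d f hc hd => ?_⟩
  have hlt' : ∀ c, β c < α c → e < c := by
    intro c hc
    by_contra h0
    rcases lt_or_eq_of_le (not_lt.1 h0) with h1 | rfl
    · exact hc.ne' (he c h1)
    · exact lt_asymm hc hlt
  have hc := hlt' c hc
  have hd := hlt' d hd
  rw [degRevLex_lt_iff]
  -- The comparison is decided at the lower of `e` and `f`, which is different from both `c` and
  -- `d`.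
  refine Or.inr ⟨by simp [Finsupp.degree_single], min e f, fun j hj => ?_, ?_⟩
  · have hje := hj.trans_le (min_le_left e f)
    have hjf := hj.trans_le (min_le_right e f)
    simp [hje.ne', hjf.ne', (hje.trans hc).ne', (hje.trans hd).ne']
  · have h1 : c ≠ min e f := ((min_le_left e f).trans_lt hc).ne'
    have h2 : d ≠ min e f := ((min_le_left e f).trans_lt hd).ne'
    rcases min_choice e f with h3 | h3
    · rw [h3] at h1 h2 ⊢
      simp [Finsupp.single_apply, h1, h2]
    · rw [h3] at h1 h2 ⊢
      simp [Finsupp.single_apply, h1, h2]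

theorem isGroebnerBasis_of_forall {σ k : Type*} [Field k] {m : MonomialOrder σ}
    {G : Set (MvPolynomial σ k)} {I : Ideal (MvPolynomial σ k)} (hG : G ⊆ I)
    (h : ∀ f ∈ I, f ≠ 0 → ∃ g ∈ G, g ≠ 0 ∧ m.degree g ≤ m.degree f) : IsGroebnerBasis m G I := by
  refine ⟨hG, le_antisymm (Ideal.span_mono (Set.image_mono hG)) (Ideal.span_le.2 ?_)⟩
  rintro _ ⟨f, hf, rfl⟩
  by_cases hf0 : f = 0
  · simp [hf0]
  obtain ⟨g, hg, hg0, hgf⟩ := h f hf hf0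
  obtain ⟨δ, hδ⟩ := exists_add_of_le hgf
  have : m.leadingTerm f =
      monomial δ (m.leadingCoeff f / m.leadingCoeff g) * m.leadingTerm g := by
    rw [MonomialOrder.leadingTerm, MonomialOrder.leadingTerm, monomial_mul, hδ, add_comm δ,
      div_mul_cancel₀ _ (m.leadingCoeff_ne_zero_iff.2 hg0)]
  rw [this]
  exact Ideal.mul_mem_left _ _ (Ideal.subset_span ⟨g, hg, rfl⟩)

/-- The remainder of division by `G` stays in `I`, but no leading monomial of `G` divides any of its
monomials, so it is zero. -/
theorem span_eq_of_forall {σ k : Type*} [Field k] {m : MonomialOrder σ}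
    {G : Set (MvPolynomial σ k)} {I : Ideal (MvPolynomial σ k)} (hG : G ⊆ I) (h0 : 0 ∉ G)
    (h : ∀ f ∈ I, f ≠ 0 → ∃ g ∈ G, g ≠ 0 ∧ m.degree g ≤ m.degree f) : Ideal.span G = I := by
  refine le_antisymm (Ideal.span_le.2 hG) fun f hf => ?_
  obtain ⟨q, r, hfr, -, hr⟩ := m.div_set (B := G) (fun b hb =>
    (m.leadingCoeff_ne_zero_iff.2 (ne_of_mem_of_not_mem hb h0)).isUnit) f
  have hq : Finsupp.linearCombination _ (fun b : G => (b : MvPolynomial σ k)) q ∈ Ideal.span G := by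
    rw [Finsupp.linearCombination_apply]
    exact Submodule.sum_mem _ fun b _ => Ideal.mul_mem_left _ _ (Ideal.subset_span b.2)
  have hrI : r ∈ I := by
    rw [← sub_eq_of_eq_add' hfr]
    exact I.sub_mem hf (Ideal.span_le.2 hG hq)
  have : r = 0 := by
    by_contra hr0
    obtain ⟨g, hg, -, hgr⟩ := h r hrI hr0
    exact hr _ (m.degree_mem_support hr0) g hg hgr
  rw [hfr, this, add_zero]
  exact hq

variable {N : ℕ} {k : Type*} [Field k]

theorem single_add_single_le {σ : Type*} {c d : σ} (hcd : c ≠ d) {α : σ →₀ ℕ} (hc : α c ≠ 0)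
    (hd : α d ≠ 0) : Finsupp.single c 1 + Finsupp.single d 1 ≤ α := by
  classical
  intro x
  simp only [Finsupp.add_apply, Finsupp.single_apply]
  split_ifs with h1 h2 h2
  · exact absurd (h1.trans h2.symm) hcd
  · subst h1; omega
  · subst h2; omega
  · omega

theorem exists_quadric_of_not_matching (m : MonomialOrder (SkewVar N)) {α : SkewVar N →₀ ℕ}
    (hα : ∀ T, vdeg α ≠ ind T) : ∃ g ∈ quadrics k N, g ≠ 0 ∧ m.degree g ≤ α := by
  classical
  obtain ⟨u, hu⟩ : ∃ u, 2 ≤ vdeg α u := by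
    by_contra! h
    -- If all degrees were at most one, `α` would be a perfect matching of the set of vertices it
    -- covers.
    apply hα (Finset.univ.filter fun u => vdeg α u ≠ 0)
    ext u
    have := h u
    simp only [ind, Finset.mem_filter, Finset.mem_univ, true_and]
    split_ifs <;> omega
  obtain ⟨c, hc, huc⟩ := exists_mem_ends_of_vdeg_ne_zero (α := α) (u := u) (by omega)
  by_cases hd : ∃ d, d ≠ c ∧ α d ≠ 0 ∧ u ∈ ends d
  · obtain ⟨d, hdc, hd, hud⟩ := hd
    refine ⟨_, X_mul_X_mem_quadrics hdc hud huc, ?_, ?_⟩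
    · exact mul_ne_zero (X_ne_zero _) (X_ne_zero _)
    · rw [X_mul_X_eq, m.degree_monomial, if_neg one_ne_zero]
      exact single_add_single_le hdc hd hc
  · push Not at hd
    refine ⟨_, X_sq_mem_quadrics c, pow_ne_zero _ (X_ne_zero _), ?_⟩
    rw [X_pow_eq_monomial, m.degree_monomial, if_neg one_ne_zero, Finsupp.single_le_iff]
    rw [vdeg, Finset.sum_eq_single c] at hu
    · simpa [ind, huc] using hu
    · intro d _ hdc
      by_cases h0 : α d = 0
      · simp [h0]
      · simp [ind, hd d hdc h0]
    · simp

/-- The edge `e` of `β` joins two vertices that `α` matches elsewhere; the exchange relation that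
trades these two edges of `α` for `e` and the edge joining their other ends has its leading monomial
in `α`. -/
theorem exists_quadric_of_matching_lt [LinearOrder (SkewVar N)] {α β : SkewVar N →₀ ℕ}
    {T : Finset (Fin N)} (hα : vdeg α = ind T) (hβ : vdeg β = ind T)
    (h : β ≺[degRevLex (SkewVar N)] α) :
    ∃ g ∈ quadrics k N, g ≠ 0 ∧ (degRevLex (SkewVar N)).degree g ≤ α := by
  have hdeg : β.degree = α.degree := by
    have h1 := sum_vdeg α
    have h2 := sum_vdeg β
    rw [hα] at h1
    rw [hβ] at h2
    omega
  obtain ⟨e, he, hlt⟩ := exists_exchange_lt h hdeg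
  have heβ : β e ≠ 0 := by omega
  have heα : α e = 0 := by have := apply_le_one hβ e; omega
  have hfind : ∀ a ∈ ends e, ∃ c a', ends c = {a, a'} ∧ a ≠ a' ∧ α c ≠ 0 := by
    intro a ha
    obtain ⟨c, hc, hac⟩ := exists_mem_ends_of_vdeg_ne_zero (α := α) (u := a) (by
      rw [hα, ind, if_pos (mem_of_mem_ends hβ heβ ha)]; exact one_ne_zero)
    rcases mem_ends.1 hac with rfl | rfl
    · exact ⟨c, _, rfl, c.2.ne, hc⟩
    · exact ⟨c, c.1.1, Finset.pair_comm _ _, c.2.ne', hc⟩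
  -- In `β` the ends of `e` are already used by `e`, so an edge of `α` at such an end is missing
  -- from `β`.
  have hβ0 : ∀ c, α c ≠ 0 → ∀ a ∈ ends e, a ∈ ends c → β c < α c := by
    intro c hc a ha hac
    have : β c = 0 := by
      by_contra h0
      rw [eq_of_mem_ends hβ h0 heβ hac ha] at hc
      exact hc heα
    omega
  have hae : e.1.1 ∈ ends e := mem_ends.2 (Or.inl rfl)
  have hbe : e.1.2 ∈ ends e := mem_ends.2 (Or.inr rfl)
  obtain ⟨c, a', hca, haa', hc⟩ := hfind _ hae
  obtain ⟨d, b', hdb, hbb', hd⟩ := hfind _ hbe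
  have hac : e.1.1 ∈ ends c := by simp [hca]
  have ha'c : a' ∈ ends c := by simp [hca]
  have hbd : e.1.2 ∈ ends d := by simp [hdb]
  have hb'd : b' ∈ ends d := by simp [hdb]
  -- A single edge of `α` covering both ends of `e` would be `e` itself, which `α` does not contain.
  have hcd : c ≠ d := by
    rintro rfl
    have hba' : e.1.2 = a' := by
      rw [hca] at hbd
      simp only [Finset.mem_insert, Finset.mem_singleton] at hbd
      exact hbd.resolve_left e.2.ne'
    have : c = e := ends_injective (by rw [hca, ← hba']; rfl)
    rw [this] at hc
    exact hc heα
  have hdis : ∀ u ∈ ends c, ∀ v ∈ ends d, u ≠ v := by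
    rintro u hu _ hv rfl
    exact hcd (eq_of_mem_ends hα hc hd hu hv)
  obtain ⟨c', s1, hc', hs1, hX1⟩ := exists_genericSkew_eq (k := k) haa'
  obtain ⟨d', s2, hd', hs2, hX2⟩ := exists_genericSkew_eq (k := k) hbb'
  obtain ⟨f, s3, hf, hs3, hX3⟩ := exists_genericSkew_eq (k := k) (hdis _ ha'c _ hb'd)
  obtain rfl : c' = c := ends_injective (hc'.trans hca.symm)
  obtain rfl : d' = d := ends_injective (hd'.trans hdb.symm)
  have hg : exchange k e.1.1 a' e.1.2 b' =
      monomial (Finsupp.single c' 1 + Finsupp.single d' 1) (s1 * s2) +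
        monomial (Finsupp.single e 1 + Finsupp.single f 1) (1 * s3) := by
    rw [exchange, hX1, hX2, hX3, genericSkew_of_lt e.2, X, monomial_mul, monomial_mul]
  have hlt := hlt c' d' f (hβ0 c' hc _ hae hac) (hβ0 d' hd _ hbe hbd)
  set m := degRevLex (SkewVar N)
  have hdg : m.degree (exchange k e.1.1 a' e.1.2 b') =
      Finsupp.single c' 1 + Finsupp.single d' 1 := by
    classical
    have h1 := m.degree_monomial (d := Finsupp.single c' 1 + Finsupp.single d' 1) (s1 * s2)
    have h2 := m.degree_monomial (d := Finsupp.single e 1 + Finsupp.single f 1) (1 * s3)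
    rw [if_neg (mul_ne_zero hs1 hs2)] at h1
    rw [if_neg (mul_ne_zero one_ne_zero hs3)] at h2
    rw [hg, m.degree_add_of_lt (by rw [h1, h2]; exact hlt), h1]
  have hg0 : exchange k e.1.1 a' e.1.2 b' ≠ 0 := by
    apply m.ne_zero_of_degree_ne_zero
    rw [hdg]
    intro h0
    have := DFunLike.congr_fun h0 c'
    simp at this
  have hle := single_add_single_le hcd hc hd
  rcases exchange_mem (k := k) haa' e.2.ne (hdis _ hac _ hb'd) (hdis _ ha'c _ hbd)
    (hdis _ ha'c _ hb'd) hbb' with h | h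
  · exact ⟨_, h, hg0, hdg.trans_le hle⟩
  · exact ⟨_, h, neg_ne_zero.2 hg0, by rw [m.degree_neg]; exact hdg.trans_le hle⟩

theorem exists_quadric_degree_le [LinearOrder (SkewVar N)] {f : MvPolynomial (SkewVar N) k}
    (hf : f ∈ apolarIdeal k N) (hf0 : f ≠ 0) :
    ∃ g ∈ quadrics k N, g ≠ 0 ∧
      (degRevLex (SkewVar N)).degree g ≤ (degRevLex (SkewVar N)).degree f := by
  set m := degRevLex (SkewVar N)
  by_cases h : ∃ T, vdeg (m.degree f) = ind T
  · obtain ⟨T, hT⟩ := h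
    -- Otherwise the functional of `T` would take a nonzero multiple of the leading coefficient as
    -- its value at `f`.
    obtain ⟨β, hβ, hne, hβT⟩ : ∃ β ∈ f.support, β ≠ m.degree f ∧ vdeg β = ind T := by
      by_contra! hcon
      have hz := mem_apolarIdeal_iff.1 hf T
      rw [functional_eq_sum, Finset.sum_eq_single_of_mem _ (m.degree_mem_support hf0)] at hz
      · exact mul_ne_zero (m.coeff_degree_ne_zero_iff.2 hf0) (weight_ne_zero_iff.2 hT) hz
      · intro β hβ hne
        rw [show weight k T β = 0 from ?_, mul_zero]
        by_contra h0
        exact hcon β hβ hne (weight_ne_zero_iff.1 h0)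
    refine exists_quadric_of_matching_lt hT hβT (lt_of_le_of_ne (m.le_degree hβ) ?_)
    exact fun h0 => hne (m.toSyn.injective h0)
  · push Not at h
    exact exists_quadric_of_not_matching m h

theorem isRevlexUniversalGroebnerBasis_quadrics :
    IsRevlexUniversalGroebnerBasis (quadrics k N) (apolarIdeal k N) := fun _ =>
  isGroebnerBasis_of_forall quadrics_subset_apolarIdeal fun _ hf hf0 =>
    exists_quadric_degree_le hf hf0

end Groebner

/-! ### An irredundant parametrization of the quadrics -/

section Family

variable {N : ℕ}

/-- The edge between two of the vertices listed by an order embedding. -/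
def edge {r : ℕ} (e : Fin r ↪o Fin N) {i j : Fin r} (h : i < j) : SkewVar N :=
  ⟨(e i, e j), e.strictMono h⟩

theorem mem_ends_edge {r : ℕ} (e : Fin r ↪o Fin N) {i j : Fin r} (h : i < j) (l : Fin r) :
    e l ∈ ends (edge e h) ↔ l = i ∨ l = j := by
  simp [mem_ends, edge]

theorem ends_edge_subset {r : ℕ} (e : Fin r ↪o Fin N) {i j : Fin r} (h : i < j) {u : Fin N}
    (hu : u ∉ Set.range e) : u ∉ ends (edge e h) := by
  rw [mem_ends]
  rintro (rfl | rfl)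
  exacts [hu ⟨i, rfl⟩, hu ⟨j, rfl⟩]

theorem edge_inj {r : ℕ} (e : Fin r ↪o Fin N) {i j i' j' : Fin r} {h : i < j} {h' : i' < j'} :
    edge e h = edge e h' ↔ i = i' ∧ j = j' := by
  simp [edge, Subtype.ext_iff, Prod.ext_iff]

theorem vdeg_edge_add_edge {r : ℕ} (e : Fin r ↪o Fin N) {i j i' j' : Fin r} (h : i < j)
    (h' : i' < j') (l : Fin r) :
    vdeg (Finsupp.single (edge e h) 1 + Finsupp.single (edge e h') 1) (e l) =
      (if l = i ∨ l = j then 1 else 0) + if l = i' ∨ l = j' then 1 else 0 := by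
  simp only [vdeg_add, vdeg_single_one, Pi.add_apply, ind, mem_ends_edge]

/-- The indices of the quadrics: edges, paths with two edges, and relations between the perfect
matchings of four vertices. -/
abbrev QuadricIndex (N : ℕ) : Type :=
  (Fin 2 ↪o Fin N) ⊕ ((Fin 3 ↪o Fin N) × Fin 3 ⊕ (Fin 4 ↪o Fin N) × Fin 3)

/-- The three paths on three vertices; the second index is the middle vertex. -/
def pathMonomial (e : Fin 3 ↪o Fin N) : Fin 3 → SkewVar N →₀ ℕ :=
  ![Finsupp.single (edge e (show 0 < 1 by decide)) 1 +
      Finsupp.single (edge e (show 0 < 2 by decide)) 1,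
    Finsupp.single (edge e (show 0 < 1 by decide)) 1 +
      Finsupp.single (edge e (show 1 < 2 by decide)) 1,
    Finsupp.single (edge e (show 0 < 2 by decide)) 1 +
      Finsupp.single (edge e (show 1 < 2 by decide)) 1]

/-- The three perfect matchings of four vertices. -/
def matching (e : Fin 4 ↪o Fin N) : Fin 3 → SkewVar N →₀ ℕ :=
  ![Finsupp.single (edge e (show 0 < 1 by decide)) 1 +
      Finsupp.single (edge e (show 2 < 3 by decide)) 1,
    Finsupp.single (edge e (show 0 < 2 by decide)) 1 +
      Finsupp.single (edge e (show 1 < 3 by decide)) 1,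
    Finsupp.single (edge e (show 0 < 3 by decide)) 1 +
      Finsupp.single (edge e (show 1 < 2 by decide)) 1]

variable (k : Type*) [Field k]

/-- The coefficients of the three relations between the perfect matchings of four vertices. -/
def relationCoeff : Fin 3 → Fin 3 → k := ![![1, 1, 0], ![0, 1, 1], ![1, 0, -1]]

/-- The three relations between the perfect matchings of four vertices. -/
def relation (e : Fin 4 ↪o Fin N) (j : Fin 3) : MvPolynomial (SkewVar N) k :=
  ∑ l, monomial (matching e l) (relationCoeff k j l)

/-- The quadrics, parametrized without repetitions. -/
def quadric : QuadricIndex N → MvPolynomial (SkewVar N) k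
  | .inl e => monomial (Finsupp.single (edge e (show 0 < 1 by decide)) 2) 1
  | .inr (.inl (e, j)) => monomial (pathMonomial e j) 1
  | .inr (.inr (e, j)) => relation k e j

/-- The common vertex degrees of the monomials of a quadric. -/
def quadricVdeg : QuadricIndex N → Fin N → ℕ
  | .inl e, u => if u ∈ Set.range e then 2 else 0
  | .inr (.inl (e, j)), u => if u ∈ Set.range e then (if u = e j then 2 else 1) else 0
  | .inr (.inr (e, _)), u => if u ∈ Set.range e then 1 else 0

variable {k}

theorem vdeg_pathMonomial (e : Fin 3 ↪o Fin N) (j : Fin 3) :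
    vdeg (pathMonomial e j) = quadricVdeg (.inr (.inl (e, j))) := by
  ext u
  by_cases hu : u ∈ Set.range e
  · obtain ⟨l, rfl⟩ := hu
    simp only [quadricVdeg, Set.mem_range_self, if_true, e.injective.eq_iff]
    fin_cases j <;> refine (vdeg_edge_add_edge e _ _ l).trans ?_ <;> fin_cases l <;> rfl
  · fin_cases j <;> simp [pathMonomial, vdeg_add, vdeg_single_one, quadricVdeg, ind, hu,
      ends_edge_subset, -Set.mem_range]

theorem vdeg_matching (e : Fin 4 ↪o Fin N) (l j : Fin 3) :
    vdeg (matching e l) = quadricVdeg (.inr (.inr (e, j))) := by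
  ext u
  by_cases hu : u ∈ Set.range e
  · obtain ⟨x, rfl⟩ := hu
    simp only [quadricVdeg, Set.mem_range_self, if_true]
    fin_cases l <;> refine (vdeg_edge_add_edge e _ _ x).trans ?_ <;> fin_cases x <;> rfl
  · fin_cases l <;> simp [matching, vdeg_add, vdeg_single_one, quadricVdeg, ind, hu,
      ends_edge_subset, -Set.mem_range]

theorem matching_disjoint (e : Fin 4 ↪o Fin N) {l l' : Fin 3} (h : l ≠ l') (c : SkewVar N) :
    matching e l c = 0 ∨ matching e l' c = 0 := by
  by_contra! h0
  obtain ⟨h1, h2⟩ := h0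
  have key : ∀ {i j i' j' : Fin 4} {hij : i < j} {hij' : i' < j'},
      (Finsupp.single (edge e hij) 1 + Finsupp.single (edge e hij') 1 : SkewVar N →₀ ℕ) c ≠ 0 →
      c = edge e hij ∨ c = edge e hij' := by
    intro i j i' j' hij hij' hc
    by_contra! h3
    simp [h3.1, h3.2] at hc
  fin_cases l <;> fin_cases l' <;> first
    | exact absurd rfl h
    | (rcases key h1 with rfl | rfl <;> rcases key h2 with h3 | h3 <;>
        exact absurd ((edge_inj e).1 h3) (by decide))

theorem matching_injective (e : Fin 4 ↪o Fin N) : Function.Injective (matching e) := by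
  intro l l' h
  by_contra hne
  have h0 : matching e l = 0 := by
    ext c
    rcases matching_disjoint e hne c with h1 | h1
    · exact h1
    · rw [h]; exact h1
  have h1 := vdeg_matching e l 0
  rw [h0, vdeg_zero] at h1
  have := congrFun h1 (e 0)
  simp [quadricVdeg] at this

theorem coeff_relation (e : Fin 4 ↪o Fin N) (j l : Fin 3) :
    coeff (matching e l) (relation k e j) = relationCoeff k j l := by
  classical
  rw [relation, coeff_sum, Finset.sum_eq_single l]
  · rw [coeff_monomial, if_pos rfl]
  · intro l' _ h
    rw [coeff_monomial, if_neg fun h0 => h (matching_injective e h0)]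
  · simp

theorem exists_eq_matching {e : Fin 4 ↪o Fin N} {j : Fin 3} {α : SkewVar N →₀ ℕ}
    (h : coeff α (relation k e j) ≠ 0) : ∃ l, α = matching e l := by
  classical
  rw [relation, coeff_sum] at h
  obtain ⟨l, -, hl⟩ := Finset.exists_ne_zero_of_sum_ne_zero h
  rw [coeff_monomial] at hl
  exact ⟨l, by by_contra h0; exact hl (if_neg fun h1 => h0 h1.symm)⟩

theorem vdeg_eq_quadricVdeg {i : QuadricIndex N} {α : SkewVar N →₀ ℕ}
    (h : coeff α (quadric k i) ≠ 0) : vdeg α = quadricVdeg i := by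
  classical
  rcases i with e | ⟨e, j⟩ | ⟨e, j⟩
  · rw [quadric, coeff_monomial] at h
    obtain rfl : _ = α := by by_contra h0; exact h (if_neg h0)
    ext u
    rw [vdeg_single]
    simp only [quadricVdeg, ind, mem_ends, edge, Set.mem_range, Fin.exists_fin_two, eq_comm]
    split_ifs <;> rfl
  · rw [quadric, coeff_monomial] at h
    obtain rfl : _ = α := by by_contra h0; exact h (if_neg h0)
    exact vdeg_pathMonomial e j
  · obtain ⟨l, rfl⟩ := exists_eq_matching h
    exact vdeg_matching e l j

theorem exists_relationCoeff_ne_zero (j : Fin 3) : ∃ l, relationCoeff k j l ≠ 0 := by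
  fin_cases j
  · exact ⟨0, by simp [relationCoeff]⟩
  · exact ⟨1, by simp [relationCoeff]⟩
  · exact ⟨0, by simp [relationCoeff]⟩

/-- Once relation `j₀` is removed, relation `j` contains a matching that the one other remaining
relation avoids. The entries are `0` and `±1`, so the zero pattern can be checked over `ℤ` and holds
in every characteristic. -/
theorem exists_relationCoeff_separating {j j₀ : Fin 3} (h : j ≠ j₀) :
    ∃ l, relationCoeff k j l ≠ 0 ∧ ∀ j', j' ≠ j → j' ≠ j₀ → relationCoeff k j' l = 0 := by
  have hd : ∃ l : Fin 3, (![![1, 1, 0], ![0, 1, 1], ![1, 0, -1]] : Fin 3 → Fin 3 → ℤ) j l ≠ 0 ∧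
      ∀ j', j' ≠ j → j' ≠ j₀ →
        (![![1, 1, 0], ![0, 1, 1], ![1, 0, -1]] : Fin 3 → Fin 3 → ℤ) j' l = 0 := by
    revert j j₀; decide
  have hz : ∀ j l, relationCoeff k j l = 0 ↔
      (![![1, 1, 0], ![0, 1, 1], ![1, 0, -1]] : Fin 3 → Fin 3 → ℤ) j l = 0 := by
    intro j l
    fin_cases j <;> fin_cases l <;> simp [relationCoeff]
  simpa only [ne_eq, hz] using hd

theorem relationCoeff_injective : Function.Injective (relationCoeff k) := by
  intro j j' h
  have h0 := congrFun h 0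
  have h1 := congrFun h 1
  have h2 := congrFun h 2
  fin_cases j <;> fin_cases j' <;> simp_all [relationCoeff]

theorem exists_coeff_quadric_ne_zero (i : QuadricIndex N) : ∃ α, coeff α (quadric k i) ≠ 0 := by
  classical
  rcases i with e | ⟨e, j⟩ | ⟨e, j⟩
  · exact ⟨_, by rw [quadric, coeff_monomial, if_pos rfl]; exact one_ne_zero⟩
  · exact ⟨_, by rw [quadric, coeff_monomial, if_pos rfl]; exact one_ne_zero⟩
  · obtain ⟨l, hl⟩ := exists_relationCoeff_ne_zero (k := k) j
    exact ⟨matching e l, by rw [quadric, coeff_relation]; exact hl⟩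

theorem card_filter_range {r : ℕ} (e : Fin r ↪o Fin N) (f : Fin N → ℕ)
    (hf : ∀ u, f u ≠ 0 ↔ u ∈ Set.range e) : (Finset.univ.filter fun u => f u ≠ 0).card = r := by
  have : (Finset.univ.filter fun u => f u ≠ 0) = Finset.univ.map e.toEmbedding := by
    ext u; simp [hf]
  rw [this, Finset.card_map, Finset.card_univ, Fintype.card_fin]

theorem embedding_ext {r : ℕ} {e e' : Fin r ↪o Fin N} {f : Fin N → ℕ}
    (hf : ∀ u, f u ≠ 0 ↔ u ∈ Set.range e) (hf' : ∀ u, f u ≠ 0 ↔ u ∈ Set.range e') : e = e' := by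
  have : Set.range e = Set.range e' := by ext u; rw [← hf, hf']
  exact DFunLike.coe_injective ((e.strictMono.range_inj e'.strictMono).1 this)

/-- The number of vertices of nonzero degree gives the type, these vertices give the embedding, and
the middle of a path is its vertex of degree two. -/
theorem eq_or_of_quadricVdeg_eq {i i' : QuadricIndex N} (h : quadricVdeg i = quadricVdeg i') :
    i = i' ∨ ∃ e j j', i = .inr (.inr (e, j)) ∧ i' = .inr (.inr (e, j')) := by
  have h2 (e : Fin 2 ↪o Fin N) (u) : quadricVdeg (.inl e) u ≠ 0 ↔ u ∈ Set.range e := by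
    simp only [quadricVdeg]; split_ifs <;> simp_all
  have h3 (e : Fin 3 ↪o Fin N) (j u) : quadricVdeg (.inr (.inl (e, j))) u ≠ 0 ↔
      u ∈ Set.range e := by
    simp only [quadricVdeg]; split_ifs <;> simp_all
  have h4 (e : Fin 4 ↪o Fin N) (j u) : quadricVdeg (.inr (.inr (e, j))) u ≠ 0 ↔
      u ∈ Set.range e := by
    simp only [quadricVdeg]; split_ifs <;> simp_all
  rcases i with e | ⟨e, j⟩ | ⟨e, j⟩ <;> rcases i' with e' | ⟨e', j'⟩ | ⟨e', j'⟩
  · left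
    rw [embedding_ext (h2 e) (h ▸ h2 e')]
  · have := card_filter_range _ _ (h2 e)
    rw [h, card_filter_range _ _ (h3 e' j')] at this
    omega
  · have := card_filter_range _ _ (h2 e)
    rw [h, card_filter_range _ _ (h4 e' j')] at this
    omega
  · have := card_filter_range _ _ (h3 e j)
    rw [h, card_filter_range _ _ (h2 e')] at this
    omega
  · left
    obtain rfl := embedding_ext (h3 e j) (h ▸ h3 e' j')
    have := congrFun h (e j)
    simp only [quadricVdeg, Set.mem_range_self, if_true, e.injective.eq_iff] at this
    split_ifs at this with hj
    · rw [hj]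
    · exact absurd this (by decide)
  · have := card_filter_range _ _ (h3 e j)
    rw [h, card_filter_range _ _ (h4 e' j')] at this
    omega
  · have := card_filter_range _ _ (h4 e j)
    rw [h, card_filter_range _ _ (h2 e')] at this
    omega
  · have := card_filter_range _ _ (h4 e j)
    rw [h, card_filter_range _ _ (h3 e' j')] at this
    omega
  · right
    obtain rfl := embedding_ext (h4 e j) (h ▸ h4 e' j')
    exact ⟨e, j, j', rfl, rfl⟩

theorem quadric_injective : Function.Injective (quadric k (N := N)) := by
  intro i i' h
  obtain ⟨α, hα⟩ := exists_coeff_quadric_ne_zero (k := k) i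
  have hv := (vdeg_eq_quadricVdeg hα).symm.trans (vdeg_eq_quadricVdeg (h ▸ hα))
  rcases eq_or_of_quadricVdeg_eq hv with h0 | ⟨e, j, j', rfl, rfl⟩
  · exact h0
  · have : j = j' := relationCoeff_injective (k := k) (funext fun l => by
      rw [← coeff_relation e, ← coeff_relation e]
      exact congrArg (coeff (matching e l)) h)
    rw [this]

/-! ### The parametrized family is the explicit set of quadrics, and its cardinality. -/

theorem relation_zero (e : Fin 4 ↪o Fin N) : relation k e 0 =
    X (edge e (show 0 < 1 by decide)) * X (edge e (show 2 < 3 by decide)) +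
      X (edge e (show 0 < 2 by decide)) * X (edge e (show 1 < 3 by decide)) := by
  simp only [X_mul_X_eq, relation, Fin.sum_univ_three, relationCoeff, matching, Matrix.cons_val,
    map_zero, add_zero]

theorem relation_one (e : Fin 4 ↪o Fin N) : relation k e 1 =
    X (edge e (show 0 < 3 by decide)) * X (edge e (show 1 < 2 by decide)) +
      X (edge e (show 0 < 2 by decide)) * X (edge e (show 1 < 3 by decide)) := by
  simp only [X_mul_X_eq, relation, Fin.sum_univ_three, relationCoeff, matching, Matrix.cons_val,
    map_zero, zero_add]
  rw [add_comm]

theorem relation_two (e : Fin 4 ↪o Fin N) : relation k e 2 =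
    X (edge e (show 0 < 1 by decide)) * X (edge e (show 2 < 3 by decide)) -
      X (edge e (show 0 < 3 by decide)) * X (edge e (show 1 < 2 by decide)) := by
  simp only [X_mul_X_eq, relation, Fin.sum_univ_three, relationCoeff, matching, Matrix.cons_val,
    map_zero, map_neg, add_zero, sub_eq_add_neg]

theorem quadrupleSet_eq_range (e : Fin 4 ↪o Fin N) :
    quadrupleSet k N (e 0) (e 1) (e 2) (e 3) = Set.range (relation k e) := by
  have h (i j : Fin 4) (hij : i < j) : genericSkew k N (e i) (e j) = X (edge e hij) :=
    genericSkew_of_lt _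
  ext f
  simp only [quadrupleSet, h 0 1 (by decide), h 0 2 (by decide), h 0 3 (by decide),
    h 1 2 (by decide), h 1 3 (by decide), h 2 3 (by decide), ← relation_zero, ← relation_one,
    ← relation_two, Set.mem_insert_iff, Set.mem_singleton_iff, Set.mem_range,
    Fin.exists_fin_succ]
  simp [eq_comm]

theorem exists_embedding_three {a b c : Fin N} (h1 : a < b) (h2 : b < c) :
    ∃ e : Fin 3 ↪o Fin N, e 0 = a ∧ e 1 = b ∧ e 2 = c := by
  refine ⟨OrderEmbedding.ofStrictMono ![a, b, c] ?_, rfl, rfl, rfl⟩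
  rw [Fin.strictMono_iff_lt_succ]
  intro i
  fin_cases i
  exacts [h1, h2]

theorem exists_embedding_four {a b c d : Fin N} (h1 : a < b) (h2 : b < c) (h3 : c < d) :
    ∃ e : Fin 4 ↪o Fin N, e 0 = a ∧ e 1 = b ∧ e 2 = c ∧ e 3 = d := by
  refine ⟨OrderEmbedding.ofStrictMono ![a, b, c, d] ?_, rfl, rfl, rfl, rfl⟩
  rw [Fin.strictMono_iff_lt_succ]
  intro i
  fin_cases i
  exacts [h1, h2, h3]

theorem quadrics_eq_range : quadrics k N = Set.range (quadric k (N := N)) := by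
  have hsq (e : Fin 2 ↪o Fin N) :
      genericSkew k N (e 0) (e 1) ^ 2 = quadric k (.inl e) := by
    rw [genericSkew_of_lt (e.strictMono (by decide)), X_pow_eq_monomial]
    rfl
  have hpath (e : Fin 3 ↪o Fin N) (f : MvPolynomial (SkewVar N) k) :
      f ∈ ({genericSkew k N (e 0) (e 1) * genericSkew k N (e 0) (e 2),
        genericSkew k N (e 0) (e 1) * genericSkew k N (e 1) (e 2),
        genericSkew k N (e 0) (e 2) * genericSkew k N (e 1) (e 2)} : Set _) ↔
      ∃ j, quadric k (.inr (.inl (e, j))) = f := by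
    have h (i j : Fin 3) (hij : i < j) : genericSkew k N (e i) (e j) = X (edge e hij) :=
      genericSkew_of_lt _
    simp only [h 0 1 (by decide), h 0 2 (by decide), h 1 2 (by decide), X_mul_X_eq, quadric,
      pathMonomial, Fin.exists_fin_succ, Set.mem_insert_iff, Set.mem_singleton_iff]
    simp [eq_comm]
  ext f
  constructor
  · rintro ((⟨a, b, h, rfl⟩ | ⟨a, b, c, h1, h2, hf⟩) | ⟨a, b, c, d, h1, h2, h3, hf⟩)
    · refine ⟨.inl (OrderEmbedding.ofStrictMono ![a, b] ?_), (hsq _).symm⟩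
      rw [Fin.strictMono_iff_lt_succ]
      intro i
      fin_cases i
      exact h
    · obtain ⟨e, rfl, rfl, rfl⟩ := exists_embedding_three h1 h2
      obtain ⟨j, hj⟩ := (hpath e f).1 hf
      exact ⟨_, hj⟩
    · obtain ⟨e, rfl, rfl, rfl, rfl⟩ := exists_embedding_four h1 h2 h3
      rw [quadrupleSet_eq_range] at hf
      obtain ⟨j, hj⟩ := hf
      exact ⟨.inr (.inr (e, j)), hj⟩
  · rintro ⟨e | ⟨e, j⟩ | ⟨e, j⟩, rfl⟩
    · exact Or.inl (Or.inl ⟨e 0, e 1, e.strictMono (by decide), (hsq e).symm⟩)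
    · exact Or.inl (Or.inr ⟨e 0, e 1, e 2, e.strictMono (by decide), e.strictMono (by decide),
        (hpath e _).2 ⟨j, rfl⟩⟩)
    · refine Or.inr ⟨e 0, e 1, e 2, e 3, e.strictMono (by decide), e.strictMono (by decide),
        e.strictMono (by decide), ?_⟩
      rw [quadrupleSet_eq_range]
      exact ⟨j, rfl⟩

theorem encard_quadrics :
    (quadrics k N).encard = (N.choose 2 + 3 * N.choose 3 + 3 * N.choose 4 : ℕ) := by
  have hc : ∀ r, Nat.card (Fin r ↪o Fin N) = N.choose r := by
    intro r
    rw [Nat.card_congr Set.powersetCard.ofFinEmbEquiv, Set.powersetCard.card, Nat.card_fin]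
  rw [quadrics_eq_range, ← Set.image_univ, quadric_injective.encard_image, Set.encard_univ,
    ENat.card_eq_coe_natCard, Nat.card_sum, Nat.card_sum, Nat.card_prod, Nat.card_prod, hc, hc, hc,
    Nat.card_fin]
  congr 1
  ring

/-! ### Homogeneity and tidiness. -/

theorem degree_of_coeff_quadric_ne_zero {i : QuadricIndex N} {α : SkewVar N →₀ ℕ}
    (h : coeff α (quadric k i) ≠ 0) : α.degree = 2 := by
  classical
  rcases i with e | ⟨e, j⟩ | ⟨e, j⟩
  · rw [quadric, coeff_monomial] at h
    obtain rfl : _ = α := by by_contra h0; exact h (if_neg h0)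
    simp [Finsupp.degree_single]
  · rw [quadric, coeff_monomial] at h
    obtain rfl : _ = α := by by_contra h0; exact h (if_neg h0)
    fin_cases j <;> simp [pathMonomial, Finsupp.degree_single]
  · obtain ⟨l, rfl⟩ := exists_eq_matching h
    fin_cases l <;> simp [matching, Finsupp.degree_single]

theorem isHomogeneous_quadric (i : QuadricIndex N) : (quadric k i).IsHomogeneous 2 := by
  intro α hα
  have := degree_of_coeff_quadric_ne_zero hα
  rw [← this, Finsupp.degree_eq_weight_one]
  rfl

theorem isQuadric_quadric (i : QuadricIndex N) : IsQuadric (quadric k i) := by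
  refine ⟨isHomogeneous_quadric i, fun h => ?_⟩
  obtain ⟨α, hα⟩ := exists_coeff_quadric_ne_zero (k := k) i
  rw [h, coeff_zero] at hα
  exact hα rfl

theorem isTidy_quadric (i : QuadricIndex N) : IsTidy (quadric k i) := by
  classical
  refine ⟨⟨2, isHomogeneous_quadric i⟩, fun v α hα β hβ hv hv' => ?_⟩
  rw [mem_support_iff] at hα hβ
  rcases i with e | ⟨e, j⟩ | ⟨e, j⟩
  · rw [quadric, coeff_monomial] at hα hβ
    exact (ite_ne_right_iff.1 hα).1.symm.trans (ite_ne_right_iff.1 hβ).1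
  · rw [quadric, coeff_monomial] at hα hβ
    exact (ite_ne_right_iff.1 hα).1.symm.trans (ite_ne_right_iff.1 hβ).1
  · obtain ⟨l, rfl⟩ := exists_eq_matching hα
    obtain ⟨l', rfl⟩ := exists_eq_matching hβ
    by_contra hne
    rcases matching_disjoint e (fun h => hne (congrArg _ h)) v with h | h
    exacts [hv h, hv' h]

end Family

/-! ### Minimal generating sets -/

section Minimal

/-- The claim is strengthened to all divisors of the monomial so that it survives multiplication; at
proper divisors the generators vanish for degree reasons. -/
theorem coeff_eq_zero_of_mem_span {σ k : Type*} [Field k] {T : Set (MvPolynomial σ k)} {d : ℕ}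
    (hT : ∀ f ∈ T, f.IsHomogeneous d) {α : σ →₀ ℕ} (hα : α.degree = d)
    (h : ∀ f ∈ T, coeff α f = 0) {f : MvPolynomial σ k} (hf : f ∈ Ideal.span T) :
    coeff α f = 0 := by
  classical
  suffices H : ∀ β ≤ α, coeff β f = 0 from H α le_rfl
  induction hf using Submodule.span_induction with
  | mem f hf =>
    intro β hβ
    by_cases hβα : β = α
    · rw [hβα, h f hf]
    · by_contra h0
      have h1 : β.degree = d := by
        have := hT f hf h0
        rwa [Finsupp.degree_eq_weight_one]
      obtain ⟨γ, rfl⟩ := exists_add_of_le hβ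
      rw [map_add] at hα
      have : γ = 0 := (Finsupp.degree_eq_zero_iff γ).1 (by omega)
      exact hβα (by rw [this, add_zero])
  | zero => simp
  | add p q _ _ hp hq =>
    intro β hβ
    rw [coeff_add, hp β hβ, hq β hβ, add_zero]
  | smul p q _ hq =>
    intro β hβ
    rw [smul_eq_mul, coeff_mul]
    refine Finset.sum_eq_zero fun x hx => ?_
    rw [hq x.2 (le_trans ?_ hβ), mul_zero]
    rw [← Finset.HasAntidiagonal.mem_antidiagonal.1 hx]
    exact le_add_self

/-- Each generator owns a monomial that no other generator contains, and among generators of equal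
degree this rules out redundancy. -/
theorem span_ne_of_ssubset {σ k ι : Type*} [Field k] {Q : ι → MvPolynomial σ k} {S : Set ι}
    {d : ℕ} (hQ : ∀ i, (Q i).IsHomogeneous d)
    (hS : ∀ i ∈ S, ∃ α, coeff α (Q i) ≠ 0 ∧ ∀ j ∈ S, j ≠ i → coeff α (Q j) = 0)
    {T : Set (MvPolynomial σ k)} (hT : T ⊂ Q '' S) :
    Ideal.span T ≠ Ideal.span (Q '' S) := by
  intro h
  obtain ⟨_, ⟨i, hi, rfl⟩, hiT⟩ := Set.exists_of_ssubset hT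
  obtain ⟨α, hα, hj⟩ := hS i hi
  have hmem : Q i ∈ Ideal.span T := h ▸ Ideal.subset_span ⟨i, hi, rfl⟩
  refine hα (coeff_eq_zero_of_mem_span (d := d) ?_ ?_ ?_ hmem)
  · intro f hf
    obtain ⟨j, -, rfl⟩ := hT.subset hf
    exact hQ j
  · have := hQ i hα
    rwa [Finsupp.degree_eq_weight_one]
  · intro f hf
    obtain ⟨j, hjS, rfl⟩ := hT.subset hf
    exact hj j hjS (by rintro rfl; exact hiT hf)

variable {N : ℕ} {k : Type*} [Field k]

theorem span_quadrics : Ideal.span (quadrics k N) = apolarIdeal k N := by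
  -- Any order of the variables serves here.
  let _ : LinearOrder (SkewVar N) := LinearOrder.lift' (Fintype.equivFin _) (Equiv.injective _)
  refine span_eq_of_forall (m := degRevLex (SkewVar N)) quadrics_subset_apolarIdeal ?_
    fun f hf hf0 => exists_quadric_degree_le hf hf0
  rw [quadrics_eq_range]
  rintro ⟨i, hi⟩
  exact (isQuadric_quadric i).2 hi

theorem relation_two_eq (e : Fin 4 ↪o Fin N) :
    relation k e 2 = relation k e 0 - relation k e 1 := by
  rw [relation_zero, relation_one, relation_two]
  ring

theorem relation_mem_span {I : Ideal (MvPolynomial (SkewVar N) k)} {e : Fin 4 ↪o Fin N}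
    {j₀ : Fin 3} (h : ∀ j, j ≠ j₀ → relation k e j ∈ I) (j : Fin 3) : relation k e j ∈ I := by
  by_cases hj : j = j₀
  · subst hj
    have h2 := relation_two_eq (k := k) e
    fin_cases j
    · have : relation k e 0 = relation k e 2 + relation k e 1 := by rw [h2, sub_add_cancel]
      change relation k e 0 ∈ I
      rw [this]
      exact I.add_mem (h 2 (by decide)) (h 1 (by decide))
    · have : relation k e 1 = relation k e 0 - relation k e 2 := by rw [h2, sub_sub_cancel]
      change relation k e 1 ∈ I
      rw [this]
      exact I.sub_mem (h 0 (by decide)) (h 2 (by decide))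
    · change relation k e 2 ∈ I
      rw [h2]
      exact I.sub_mem (h 0 (by decide)) (h 1 (by decide))
  · exact h j hj

theorem isMinimalGeneratingSet_sdiff
    {r : Fin N → Fin N → Fin N → Fin N → MvPolynomial (SkewVar N) k}
    (hr : ∀ a b c d, a < b → b < c → c < d → r a b c d ∈ quadrupleSet k N a b c d) :
    IsMinimalGeneratingSet
      (quadrics k N \ {f | ∃ a b c d, a < b ∧ b < c ∧ c < d ∧ f = r a b c d})
      (apolarIdeal k N) := by
  have hj₀ : ∀ e : Fin 4 ↪o Fin N, ∃ j, relation k e j = r (e 0) (e 1) (e 2) (e 3) := by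
    intro e
    have := hr (e 0) (e 1) (e 2) (e 3) (e.strictMono (by decide)) (e.strictMono (by decide))
      (e.strictMono (by decide))
    rwa [quadrupleSet_eq_range] at this
  choose j₀ hj₀ using hj₀
  set S : Set (QuadricIndex N) := {i | ∀ e, i ≠ .inr (.inr (e, j₀ e))}
  have hS : quadrics k N \ {f | ∃ a b c d, a < b ∧ b < c ∧ c < d ∧ f = r a b c d} =
      quadric k '' S := by
    rw [quadrics_eq_range]
    ext f
    constructor
    · rintro ⟨⟨i, rfl⟩, hi⟩
      refine ⟨i, ?_, rfl⟩
      rintro e rfl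
      exact hi ⟨e 0, e 1, e 2, e 3, e.strictMono (by decide), e.strictMono (by decide),
        e.strictMono (by decide), hj₀ e⟩
    · rintro ⟨i, hi, rfl⟩
      refine ⟨⟨i, rfl⟩, ?_⟩
      rintro ⟨a, b, c, d, h1, h2, h3, h⟩
      obtain ⟨e, rfl, rfl, rfl, rfl⟩ := exists_embedding_four h1 h2 h3
      rw [← hj₀] at h
      exact hi e (quadric_injective h)
  rw [hS]
  have hspan : Ideal.span (quadric k '' S) = apolarIdeal k N := by
    rw [← span_quadrics]
    refine le_antisymm (Ideal.span_mono ?_) (Ideal.span_le.2 ?_)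
    · rw [← hS]; exact Set.sdiff_subset
    · rw [quadrics_eq_range]
      rintro _ ⟨i, rfl⟩
      rcases i with e | ⟨e, j⟩ | ⟨e, j⟩
      · exact Ideal.subset_span ⟨_, fun _ => by simp, rfl⟩
      · exact Ideal.subset_span ⟨_, fun _ => by simp, rfl⟩
      · refine relation_mem_span (j₀ := j₀ e) (fun j hj => ?_) j
        refine Ideal.subset_span ⟨.inr (.inr (e, j)), ?_, rfl⟩
        intro e' h
        simp only [Sum.inr.injEq, Prod.mk.injEq] at h
        exact hj (h.1 ▸ h.2)
  refine ⟨hspan, fun T hT => hspan ▸ span_ne_of_ssubset isHomogeneous_quadric ?_ hT⟩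
  intro i hi
  -- A square or a path is determined by its vertex degrees, so any of its monomials is its own.
  have hgen : (∀ e j, i ≠ .inr (.inr (e, j))) → ∃ α, coeff α (quadric k i) ≠ 0 ∧
      ∀ j ∈ S, j ≠ i → coeff α (quadric k j) = 0 := by
    intro hne
    obtain ⟨α, hα⟩ := exists_coeff_quadric_ne_zero (k := k) i
    refine ⟨α, hα, fun j _ hji => ?_⟩
    by_contra h0
    have hv := (vdeg_eq_quadricVdeg hα).symm.trans (vdeg_eq_quadricVdeg h0)
    rcases eq_or_of_quadricVdeg_eq hv with h1 | ⟨e, j, j', h1, -⟩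
    exacts [hji h1.symm, hne e j h1]
  rcases i with e | ⟨e, j⟩ | ⟨e, j⟩
  · exact hgen (by simp)
  · exact hgen (by simp)
  · have hj : j ≠ j₀ e := by
      rintro rfl
      exact hi e rfl
    obtain ⟨l, hl, hl'⟩ := exists_relationCoeff_separating (k := k) hj
    refine ⟨matching e l, by rw [quadric, coeff_relation]; exact hl, fun i' hi' hne => ?_⟩
    by_contra h0
    have hv := (vdeg_matching e l j).symm.trans (vdeg_eq_quadricVdeg h0)
    rcases eq_or_of_quadricVdeg_eq hv with h1 | ⟨e', j₁, j', h1, rfl⟩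
    · exact hne h1.symm
    · simp only [Sum.inr.injEq, Prod.mk.injEq] at h1
      obtain ⟨rfl, rfl⟩ := h1
      rw [quadric, coeff_relation] at h0
      refine h0 (hl' j' ?_ ?_)
      · rintro rfl; exact hne rfl
      · rintro rfl; exact hi' e rfl

end Minimal

/-! ### The grading of the quotient by a homogeneous ideal -/

section Grading

variable {σ k : Type*} [Field k] {I : Ideal (MvPolynomial σ k)}

theorem span_range_mk_X (I : Ideal (MvPolynomial σ k)) :
    Submodule.span k (Set.range fun v => Ideal.Quotient.mk I (X v)) = quotientGrading I 1 := by
  rw [quotientGrading, homogeneousSubmodule_one_eq_span_X, Submodule.map_span, ← Set.range_comp]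
  rfl

theorem mk_mem_quotientGrading {d : ℕ} {f : MvPolynomial σ k} (hf : f.IsHomogeneous d) :
    Ideal.Quotient.mk I f ∈ quotientGrading I d :=
  ⟨f, hf, rfl⟩

theorem isInternal_quotientGrading (hI : ∀ f ∈ I, ∀ d, homogeneousComponent d f ∈ I) :
    DirectSum.IsInternal (quotientGrading I) := by
  classical
  -- As `I` is homogeneous, taking homogeneous components descends to the quotient; these
  -- projections separate the summands.
  obtain ⟨p, hp'⟩ : ∃ p : ℕ → ((MvPolynomial σ k ⧸ I) →ₗ[k] (MvPolynomial σ k ⧸ I)),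
      ∀ d f, p d (Ideal.Quotient.mk I f) = Ideal.Quotient.mk I (homogeneousComponent d f) :=
    ⟨fun d => Submodule.mapQ (I.restrictScalars k) (I.restrictScalars k)
      (homogeneousComponent d) fun f hf => hI f hf d, fun _ _ => rfl⟩
  have hp : ∀ d e, ∀ x ∈ quotientGrading I e, p d x = if d = e then x else 0 := by
    rintro d e _ ⟨f, hf, rfl⟩
    refine (hp' d f).trans ?_
    rw [homogeneousComponent_of_mem hf]
    split_ifs <;> rfl
  refine DirectSum.isInternal_submodule_of_iSupIndep_of_iSup_eq_top ?_ ?_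
  · intro d
    rw [Submodule.disjoint_def]
    intro x hx hx'
    have h0 : (⨆ e, ⨆ (_ : e ≠ d), quotientGrading I e) ≤ LinearMap.ker (p d) := by
      refine iSup₂_le fun e hed x hx => ?_
      rw [LinearMap.mem_ker, hp d e x hx, if_neg hed.symm]
    have h1 := h0 hx'
    rw [LinearMap.mem_ker, hp d d x hx, if_pos rfl] at h1
    exact h1
  · rw [eq_top_iff]
    rintro x -
    obtain ⟨f, rfl⟩ := Ideal.Quotient.mk_surjective x
    rw [← sum_homogeneousComponent f, map_sum]
    exact Submodule.sum_mem _ fun d _ => Submodule.mem_iSup_of_mem d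
      (mk_mem_quotientGrading (homogeneousComponent_isHomogeneous d f))

theorem isStandardGraded_quotientGrading [Finite σ] (hI : I ≠ ⊤)
    (hI' : ∀ f ∈ I, ∀ d, homogeneousComponent d f ∈ I) :
    IsStandardGraded k (quotientGrading I) where
  nontrivial := Ideal.Quotient.nontrivial_iff.2 hI
  gradedMonoid :=
    { one_mem := ⟨1, isHomogeneous_one σ k, rfl⟩
      mul_mem := by
        rintro i j _ _ ⟨f, hf, rfl⟩ ⟨g, hg, rfl⟩
        exact ⟨f * g, IsHomogeneous.mul hf hg, rfl⟩ }
  isInternal := isInternal_quotientGrading hI'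
  degree_zero := by
    ext x
    constructor
    · rintro ⟨f, hf, rfl⟩
      refine ⟨coeff 0 f, ?_⟩
      have h := homogeneousComponent_zero f
      rw [homogeneousComponent_eq_self hf] at h
      conv_rhs => rw [h]
      rfl
    · rintro ⟨a, rfl⟩
      exact ⟨C a, isHomogeneous_C σ a, rfl⟩
  adjoin_degree_one := by
    rw [eq_top_iff]
    have h1 : (Algebra.adjoin k (Set.range (X : σ → MvPolynomial σ k))).map
        (Ideal.Quotient.mkₐ k I) ≤ Algebra.adjoin k (quotientGrading I 1 : Set _) := by
      rw [AlgHom.map_adjoin]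
      refine Algebra.adjoin_mono ?_
      rintro _ ⟨_, ⟨v, rfl⟩, rfl⟩
      exact mk_mem_quotientGrading (isHomogeneous_X k v)
    refine le_trans ?_ h1
    rw [adjoin_range_X, Algebra.map_top]
    rintro x -
    exact Ideal.Quotient.mk_surjective x
  finite_degree_one := by
    rw [← span_range_mk_X]
    exact Module.Finite.span_of_finite k (Set.finite_range _)

end Grading

/-! ### The strong Koszul property -/

section Koszul

variable {N : ℕ} {k : Type*} [Field k]

/-- The functional of `T` only sees the component of degree `|T| / 2`. -/
theorem homogeneousComponent_mem_apolarIdeal {f : MvPolynomial (SkewVar N) k}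
    (hf : f ∈ apolarIdeal k N) (d : ℕ) : homogeneousComponent d f ∈ apolarIdeal k N := by
  rw [mem_apolarIdeal_iff] at hf ⊢
  intro T
  have key : ∀ f : MvPolynomial (SkewVar N) k, functional k T (homogeneousComponent d f) =
      if T.card = 2 * d then functional k T f else 0 := by
    intro f
    induction f using MvPolynomial.induction_on' with
    | monomial α a =>
      rw [homogeneousComponent_of_mem (isHomogeneous_monomial a rfl), apply_ite (functional k T),
        functional_monomial, map_zero]
      by_cases hα : vdeg α = ind T
      · have h1 := sum_vdeg α
        rw [hα, sum_ind] at h1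
        rw [h1]
        refine if_congr ?_ rfl rfl
        omega
      · have : weight k T α = 0 := by
          by_contra h0
          exact hα (weight_ne_zero_iff.1 h0)
        simp [this]
    | add p q hp hq =>
      rw [map_add, map_add, hp, hq, map_add]
      split_ifs <;> simp
  rw [key, hf T, ite_self]

theorem apolarIdeal_ne_top : apolarIdeal k N ≠ ⊤ := by
  rw [Ideal.ne_top_iff_one, mem_apolarIdeal_iff]
  intro h
  have := h ∅
  rw [functional_one, if_pos rfl] at this
  exact one_ne_zero this

theorem functional_X (T : Finset (Fin N)) (c : SkewVar N) :
    functional k T (X c) = if ends c = T then 1 else 0 := by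
  classical
  have h : crossingSign (Finsupp.single c 1) = 1 := by
    rw [← add_zero (Finsupp.single c 1), crossingSign_single_add, crossingSign_zero]
    simp
  rw [X, functional_monomial, weight, vdeg_single_one, h, one_mul, Int.cast_one]
  simp only [ind_injective.eq_iff]

theorem linearIndependent_mk_X : LinearIndependent k
    fun v : SkewVar N => Ideal.Quotient.mk (apolarIdeal k N) (X v) := by
  rw [Fintype.linearIndependent_iff]
  intro g hg v
  have h : (∑ v, g v • X v : MvPolynomial (SkewVar N) k) ∈ apolarIdeal k N := by
    rw [← Ideal.Quotient.eq_zero_iff_mem, ← hg, map_sum]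
    rfl
  have h1 := mem_apolarIdeal_iff.1 h (ends v)
  rw [map_sum] at h1
  simpa [functional_X, ends_injective.eq_iff] using h1

/-! ### Dual elements of the functionals, and colon ideals. -/

theorem exists_dual_X_mul {T : Finset (Fin N)} {c : SkewVar N} (hc : ends c ⊆ T)
    {μ : MvPolynomial (SkewVar N) k}
    (hμ : ∀ U, functional k U μ = if U = T \ ends c then 1 else 0) :
    ∃ s : k, ∀ U, functional k U (X c * (s • μ)) = if U = T then 1 else 0 := by
  refine ⟨(edgeSign c (T \ ends c) : k)⁻¹, fun U => ?_⟩
  rw [functional_X_mul, map_smul, hμ, smul_eq_mul]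
  by_cases hU : U = T
  · subst hU
    rw [if_pos hc, if_pos rfl, if_pos rfl, mul_one,
      mul_inv_cancel₀ (isUnit_cast (isUnit_edgeSign _ _))]
  · rw [if_neg hU]
    split_ifs with h1 h2
    · exact absurd (by rw [← Finset.sdiff_union_of_subset h1, h2,
        Finset.sdiff_union_of_subset hc]) hU
    · simp
    · rfl

/-- A suitable multiple of the monomial of any perfect matching of `T` works: such a monomial is
seen by no other functional. -/
theorem exists_dual {T : Finset (Fin N)} (hT : Even T.card) :
    ∃ μ : MvPolynomial (SkewVar N) k, ∀ U, functional k U μ = if U = T then 1 else 0 := by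
  generalize hn : T.card = n at hT
  induction n using Nat.strong_induction_on generalizing T with
  | _ n ih =>
    obtain ⟨r, hr⟩ := hT
    rcases Nat.eq_zero_or_pos n with h0 | hpos
    · obtain rfl := Finset.card_eq_zero.1 (hn.trans h0)
      exact ⟨1, functional_one⟩
    · obtain ⟨a, ha, b, hb, hab⟩ := Finset.one_lt_card.1 (show 1 < T.card by omega)
      obtain ⟨c, -, hc⟩ := exists_edge ha hb hab
      have hcard : (T \ ends c).card = n - 2 := by
        rw [Finset.card_sdiff_of_subset hc, hn, card_ends]
      obtain ⟨μ, hμ⟩ := ih (n - 2) (by omega) hcard ⟨r - 1, by omega⟩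
      obtain ⟨s, hs⟩ := exists_dual_X_mul hc hμ
      exact ⟨_, hs⟩

/-- The matching is chosen to contain the edge `c` of `A`. -/
theorem exists_dual_mem_span {T : Finset (Fin N)} (hT : Even T.card) {A : Set (SkewVar N)}
    {c : SkewVar N} (hcA : c ∈ A) (hc : ends c ⊆ T) :
    ∃ μ ∈ Ideal.span (X '' A : Set (MvPolynomial (SkewVar N) k)),
      ∀ U, functional k U μ = if U = T then 1 else 0 := by
  have hT' : Even (T \ ends c).card := by
    rw [Finset.card_sdiff_of_subset hc, card_ends]
    obtain ⟨r, hr⟩ := hT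
    exact ⟨r - 1, by omega⟩
  obtain ⟨μ, hμ⟩ := exists_dual (k := k) hT'
  obtain ⟨s, hs⟩ := exists_dual_X_mul hc hμ
  exact ⟨_, Ideal.mul_mem_right _ _ (Ideal.subset_span ⟨c, hcA, rfl⟩), hs⟩

/-- The preimage in the polynomial ring of the ideal generated by a set of residue classes of
variables consists of the polynomials that are annihilated by the functionals of the sets that
contain no edge from the given set. -/
theorem mem_span_X_sup_apolarIdeal_iff {A : Set (SkewVar N)} {f : MvPolynomial (SkewVar N) k} :
    f ∈ Ideal.span (X '' A) ⊔ apolarIdeal k N ↔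
      ∀ T, (∀ c ∈ A, ¬ends c ⊆ T) → functional k T f = 0 := by
  constructor
  · intro hf T hT
    obtain ⟨g, hg, h, hh, rfl⟩ := Submodule.mem_sup.1 hf
    rw [map_add, mem_apolarIdeal_iff.1 hh T, add_zero]
    -- Allowing all multiples of `g` makes the induction over the ideal go through.
    suffices H : ∀ p, functional k T (p * g) = 0 by simpa using H 1
    clear hf
    induction hg using Submodule.span_induction with
    | mem x hx =>
      obtain ⟨c, hc, rfl⟩ := hx
      intro p
      rw [mul_comm, functional_X_mul, if_neg (hT c hc)]
    | zero => simp
    | add x y _ _ hx hy =>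
      intro p
      rw [mul_add, map_add, hx, hy, add_zero]
    | smul a x _ hx =>
      intro p
      rw [smul_eq_mul, ← mul_assoc, hx]
  · intro hf
    have hμ : ∀ T, ∃ μ ∈ Ideal.span (X '' A : Set (MvPolynomial (SkewVar N) k)),
        ∀ U, functional k U μ = if U = T then functional k T f else 0 := by
      intro T
      by_cases h0 : functional k T f = 0
      · exact ⟨0, Ideal.zero_mem _, fun U => by simp [h0]⟩
      · have hE : Even T.card := by
          by_contra hE
          exact h0 (functional_eq_zero_of_odd hE f)
        obtain ⟨c, hcA, hc⟩ : ∃ c ∈ A, ends c ⊆ T := by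
          by_contra! h
          exact h0 (hf T h)
        obtain ⟨μ, hμ, h⟩ := exists_dual_mem_span (k := k) hE hcA hc
        refine ⟨C (functional k T f) * μ, Ideal.mul_mem_left _ _ hμ, fun U => ?_⟩
        rw [← smul_eq_C_mul, map_smul, h, smul_eq_mul, mul_ite, mul_one, mul_zero]
    choose μ hμ hμ' using hμ
    -- The sum of the `μ T` lies in the ideal generated by `A` and has the same functionals as `f`,
    -- so the difference is apolar.
    rw [← add_sub_cancel (∑ T, μ T) f]
    refine Submodule.add_mem_sup (Submodule.sum_mem _ fun T _ => hμ T) ?_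
    rw [mem_apolarIdeal_iff]
    intro U
    rw [map_sub, map_sum]
    simp [hμ']

theorem X_mul_X_mem_apolarIdeal {c d : SkewVar N} {u : Fin N} (hc : u ∈ ends c)
    (hd : u ∈ ends d) : (X c * X d : MvPolynomial (SkewVar N) k) ∈ apolarIdeal k N :=
  mem_apolarIdeal_iff.2 fun T => functional_X_mul_X_of_not_disjoint hc hd T

/-- Let `C` be the set of variables that multiply `x_i` into `(A) + I`; it contains `A` and all
edges meeting `i`. Suppose the functional of some `T` without edges of `C` does not vanish on `f`.
Then `T` is disjoint from `i`, and `ends i ∪ T` must contain an edge of `A`. This edge joins some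
`t` in `T` to an end of `i`. Any edge of `T` at `t` then belongs to `C`, a contradiction. -/
theorem mul_X_mem_span_X_sup_apolarIdeal_iff {A : Set (SkewVar N)} {i : SkewVar N} (hi : i ∉ A)
    {f : MvPolynomial (SkewVar N) k} :
    f * X i ∈ Ideal.span (X '' A) ⊔ apolarIdeal k N ↔
      f ∈ Ideal.span (X '' {c | (X c * X i : MvPolynomial (SkewVar N) k) ∈
        Ideal.span (X '' A) ⊔ apolarIdeal k N}) ⊔ apolarIdeal k N := by
  set J := Ideal.span (X '' A) ⊔ apolarIdeal k N with hJ
  constructor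
  · intro hf
    rw [mem_span_X_sup_apolarIdeal_iff]
    intro T hT
    by_contra h0
    obtain ⟨r, hr⟩ : Even T.card := by
      by_contra hE
      exact h0 (functional_eq_zero_of_odd hE f)
    have hpair : ∀ t ∈ T, ∃ c : SkewVar N, t ∈ ends c ∧ ends c ⊆ T := by
      intro t ht
      have hpos := Finset.card_pos.2 ⟨t, ht⟩
      obtain ⟨t', ht', hne⟩ := Finset.exists_mem_ne (show 1 < T.card by omega) t
      obtain ⟨c, hc, hcT⟩ := exists_edge ht ht' hne.symm
      exact ⟨c, by simp [hc], hcT⟩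
    -- A common vertex would lie on an edge inside `T` that meets `i`, and the product of that edge
    -- with `x_i` is apolar.
    have hdisj : Disjoint (ends i) T := by
      rw [Finset.disjoint_left]
      intro u hui huT
      obtain ⟨c, huc, hcT⟩ := hpair u huT
      exact hT c (Ideal.mem_sup_right (X_mul_X_mem_apolarIdeal huc hui)) hcT
    obtain ⟨a, haA, ha⟩ : ∃ a ∈ A, ends a ⊆ ends i ∪ T := by
      by_contra! h
      have h1 := mem_span_X_sup_apolarIdeal_iff.1 hf (ends i ∪ T) h
      rw [mul_comm, functional_X_mul, if_pos Finset.subset_union_left,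
        Finset.union_sdiff_cancel_left hdisj] at h1
      exact mul_ne_zero (isUnit_cast (isUnit_edgeSign _ _)) h0 h1
    have hai : ¬ends a ⊆ ends i := by
      intro h
      have := Finset.eq_of_subset_of_card_le h (by rw [card_ends, card_ends])
      exact hi (ends_injective this ▸ haA)
    obtain ⟨t, hta, hti⟩ := Finset.not_subset.1 hai
    have htT : t ∈ T := (Finset.mem_union.1 (ha hta)).resolve_left hti
    by_cases haT : ends a ⊆ T
    · exact hT a (Ideal.mem_sup_left (Ideal.mul_mem_right _ _
        (Ideal.subset_span ⟨a, haA, rfl⟩))) haT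
    obtain ⟨u, hua, huT⟩ := Finset.not_subset.1 haT
    have hui : u ∈ ends i := (Finset.mem_union.1 (ha hua)).resolve_right huT
    obtain ⟨c, htc, hcT⟩ := hpair t htT
    refine hT c ?_ hcT
    change X c * X i ∈ J
    -- A set `U` on which the functional sees `x_c x_i` contains both `t` and `u`, hence the edge
    -- `a` of `A` joining them.
    rw [hJ, mem_span_X_sup_apolarIdeal_iff]
    intro U hU
    by_contra hne
    have hcU : ends c ⊆ U := by
      by_contra h
      rw [functional_X_mul, if_neg h] at hne
      exact hne rfl
    have hiU : ends i ⊆ U := by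
      by_contra h
      rw [mul_comm, functional_X_mul, if_neg h] at hne
      exact hne rfl
    refine hU a haA ?_
    have htu : t ≠ u := by rintro rfl; exact huT htT
    have : ({t, u} : Finset (Fin N)) = ends a :=
      Finset.eq_of_subset_of_card_le (by simp [Finset.insert_subset_iff, hta, hua])
        (by rw [card_ends, Finset.card_pair htu])
    rw [← this]
    simp [Finset.insert_subset_iff, hcU htc, hiU hui]
  · intro hf
    rw [mul_comm]
    have h : Ideal.span (X '' {c | (X c * X i : MvPolynomial (SkewVar N) k) ∈ J}) ⊔
        apolarIdeal k N ≤ J.colon {X i} := by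
      refine sup_le (Ideal.span_le.2 ?_) fun g hg => ?_
      · rintro _ ⟨c, hc, rfl⟩
        exact Submodule.mem_colon_singleton.2 hc
      · exact Submodule.mem_colon_singleton.2
          (Ideal.mul_mem_right _ _ (Ideal.mem_sup_right hg))
    rw [mul_comm]
    exact Submodule.mem_colon_singleton.1 (h hf)

theorem isStronglyKoszulWrt_apolarIdeal :
    IsStronglyKoszulWrt (quotientGrading (apolarIdeal k N))
      (fun v : SkewVar N => Ideal.Quotient.mk (apolarIdeal k N) (X v)) where
  standard := isStandardGraded_quotientGrading apolarIdeal_ne_top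
    fun _ hf d => homogeneousComponent_mem_apolarIdeal hf d
  linearIndependent := linearIndependent_mk_X
  span_eq := span_range_mk_X _
  colon A i hi := by
    have hmem : ∀ (A : Set (SkewVar N)) (f : MvPolynomial (SkewVar N) k),
        Ideal.Quotient.mk (apolarIdeal k N) f ∈ Ideal.span
          ((fun v : SkewVar N => Ideal.Quotient.mk (apolarIdeal k N) (X v)) '' A) ↔
        f ∈ Ideal.span (X '' A) ⊔ apolarIdeal k N := by
      intro A f
      rw [← Ideal.mem_quotient_iff_mem_sup, Ideal.map_span, ← Set.image_comp]
      rfl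
    refine ⟨{c | (X c * X i : MvPolynomial (SkewVar N) k) ∈
      Ideal.span (X '' A) ⊔ apolarIdeal k N}, ?_⟩
    ext x
    obtain ⟨f, rfl⟩ := Ideal.Quotient.mk_surjective x
    rw [Submodule.mem_colon_singleton, smul_eq_mul, ← map_mul, hmem,
      mul_X_mem_span_X_sup_apolarIdeal_iff hi, ← hmem]

end Koszul

end PfaffianApolarity

end

open PfaffianApolarity in
theorem mainTheorem8 (k : Type*) [Field k] (N : ℕ) :
    ((∀ g ∈ quadrics k N, IsTidy g ∧ IsQuadric g) ∧
      IsRevlexUniversalGroebnerBasis (quadrics k N) (apolarIdeal k N) ∧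
      (quadrics k N).encard = (N.choose 2 + 3 * N.choose 3 + 3 * N.choose 4 : ℕ)) ∧
    (∀ r : Fin N → Fin N → Fin N → Fin N → MvPolynomial (SkewVar N) k,
      (∀ a b c d, a < b → b < c → c < d → r a b c d ∈ quadrupleSet k N a b c d) →
      IsMinimalGeneratingSet
        (quadrics k N \ {f | ∃ a b c d, a < b ∧ b < c ∧ c < d ∧ f = r a b c d})
        (apolarIdeal k N)) ∧
    IsStronglyKoszulWrt (quotientGrading (apolarIdeal k N))
      (fun v : SkewVar N => Ideal.Quotient.mk (apolarIdeal k N) (MvPolynomial.X v)) := by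
  refine ⟨⟨?_, isRevlexUniversalGroebnerBasis_quadrics, encard_quadrics⟩,
    fun r hr => isMinimalGeneratingSet_sdiff hr, isStronglyKoszulWrt_apolarIdeal⟩
  rw [quadrics_eq_range]
  rintro _ ⟨i, rfl⟩
  exact ⟨isTidy_quadric i, isQuadric_quadric i⟩
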